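/- Let $G$ be a compact semisimple Lie group with Lie algebra $\mathfrak g$, let $\mathrm{Kil}$ be the negative of its Killing form (which is positive definite), let $K$ be a closed subgroup of $G$ with Lie algebra $\mathfrak k$, let $\mathfrak m=\mathfrak k^{\perp}$ with respect to $\mathrm{Kil}$, and let $P$ be the projection of $\mathfrak g$ onto $\mathfrak m$ along $\mathfrak k$. Let $A=C^\infty_{\mathbb R}(G/K)$, viewed as the right $K$-invariant functions on $G$, and let $$\mathcal T(G/K)=\{V\in C^\infty(G,\mathfrak m): V(xs)=\mathrm{Ad}_s^{-1}V(x)\ \text{for } x\in G,\ s\in K\}$$ be the $A$-module of vector fields on $G/K$; $V$ acts on $A$ by $(\delta_Vf)(x)=\frac{d}{dt}\big|_{0}f(x\exp(tV(x)))$, and $G$ acts on $\mathcal T(G/K)$ by translation. The canonical connection is $(\nabla^c_VW)(x)=\frac{d}{dt}\big|_{0}W(x\exp(tV(x)))$. For $X\in\mathfrak g$ let $\hat X\in\mathcal T(G/K)$ be $\hat X(x)=-P\,\mathrm{Ad}_x^{-1}X$. Let $(G/K,g_0,J)$ be almost Hermitian: $g_0$ is an inner product on $\mathfrak m$ and $J$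 is a complex structure on $\mathfrak m$ orthogonal for $g_0$, both invariant under $\mathrm{Ad}(K)$. Let $S$ be the operator on $\mathfrak m$ with $g_0(X,Y)=\mathrm{Kil}(SX,Y)$, and $S^{1/2}$ its $\mathrm{Kil}$-positive square root. Let $\mathfrak m_J$ be $\mathfrak m$ as a complex vector space with $iX=JX$ and inner product $\langle X,Y\rangle_J=g_0(X,Y)+ig_0(JX,Y)$, linear in $Y$. Let $\mathcal S=\bigwedge^*\mathfrak m_J$, with inner product $\langle X_1\wedge\dots\wedge X_p,\,Y_1\wedge\dots\wedge Y_q\rangle=\delta_{pq}\det[\langle X_k,Y_l\rangle_J]$ and the Clifford action $\kappa(X)=i(a(X)+a^\dagger(X))$, where $a^\dagger(X)\psi=X\wedge\psi$ and $a(X)(X_1\wedge\dots\wedge X_p)=\sum_j(-1)^{j-1}\langle X,X_j\rangle_J\,X_1\wedge\dots\wedge\widehat{X_j}\wedge\dots\wedge X_p$. Let $\chi$ be a (continuous, unitary) character of $K$ and $$\mathcal S(G/K,\chi)=\{\psi\in C^\infty(G,\mathcal S):\psi(xs)=\bar\chi(s)\,\mathrm{Ad}_s^{-1}(\psi(x))\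 \text{for } x\in G,\ s\in K\},$$ where $K$ acts on $\mathcal S$ by exterior-algebra automorphisms extending $\mathrm{Ad}$. Let $\nabla$ be a $G$-invariant connection on $\mathcal T(G/K)$ that is compatible with $g_0$ and commutes with $J$, and let $L=\nabla-\nabla^c$. Each $L_V$ is an $A$-module endomorphism, given by $(L_VW)(x)=L_V(x)(W(x))$ with $L_V(x)\in\mathrm{End}(\mathfrak m)$ commuting with $J$; let $L^{\mathcal S}_V(x)$ be its extension to a derivation of $\mathcal S$. Put $(\nabla^{\mathcal S}_V\psi)(x)=\frac{d}{dt}\big|_0\psi(x\exp(tV(x)))+L^{\mathcal S}_V(x)\psi(x)$. The Dirac operator is $D^\nabla\psi=\kappa(\mathrm{grad}\,\psi)$, where $\mathrm{grad}\,\psi$ corresponds to $V\mapsto\nabla^{\mathcal S}_V\psi$ under the identification of $\mathfrak m$ with its dual by $g_0$. It is formally self-adjoint if $\int_G\langle D^\nabla\psi,\varphi\rangle=\int_G\langle\psi,D^\nabla\varphi\rangle$ (Haar measure) for all $\psi,\varphi\in\mathcal S(G/K,\chi)$. A standard module frame is a finite family $\{W_j\}$ in $\mathcal T(G/K)$ with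 $V=\sum_jW_j\,g_0(W_j,V)$ for all $V\in\mathcal T(G/K)$. Then: 1. $D^\nabla$ is formally self-adjoint if and only if $\sum_jL_{W_j}W_j=0$ for every standard module frame $\{W_j\}$, and also if and only if $\sum_jL_{W_j}W_j=0$ for some standard module frame. 2. There is an $\mathrm{Ad}(K)$-invariant $Z\in\mathfrak m$ such that, for every standard module frame $\{W_j\}$, $\sum_jL_{W_j}W_j$ is the constant function $Z$ on $G$. 3. $D^\nabla$ is formally self-adjoint if and only if $\sum_pL_{\hat X_p}(e)(S^{-1/2}Y_p)=0$, where $X_p=S^{1/2}Y_p$, for every $g_0$-orthonormal basis $\{Y_p\}$ of $\mathfrak m$, and also if and only if this holds for some such basis. -/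

import Mathlib

open scoped Manifold ContDiff

set_option linter.unusedSectionVars false
set_option linter.unnecessarySeqFocus false

noncomputable section

namespace HomDirac

section Spinors

/-- A real vector space with an inner product `g` and a complex structure `J` orthogonal for `g`. -/
structure HermSpace (M : Type*) [AddCommGroup M] [Module ℝ M] where
  /-- the inner product -/
  g : LinearMap.BilinForm ℝ M
  symm : ∀ X Y, g X Y = g Y X
  pos : ∀ X, X ≠ 0 → 0 < g X X
  /-- the complex structure -/
  J : M →ₗ[ℝ] M
  J_sq : ∀ X, J (J X) = -X
  J_orth : ∀ X Y, g (J X) (J Y) = g X Y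

namespace HermSpace

variable {M : Type*} [AddCommGroup M] [Module ℝ M] (h : HermSpace M)

/-- `M` viewed as a complex vector space `M_J`, with `i X = J X`. -/
def MJ (_ : HermSpace M) : Type _ := M

instance : AddCommGroup h.MJ := inferInstanceAs (AddCommGroup M)

/-- The identity map from `M` to `M_J`. -/
def toMJ : M ≃+ h.MJ := AddEquiv.refl M

instance : SMul ℂ h.MJ where
  smul z X := h.toMJ (z.re • h.toMJ.symm X + z.im • h.J (h.toMJ.symm X))

theorem smul_def (z : ℂ) (X : h.MJ) :
    z • X = h.toMJ (z.re • h.toMJ.symm X + z.im • h.J (h.toMJ.symm X)) := rfl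

instance : Module ℂ h.MJ where
  one_smul X := by simp [smul_def]
  mul_smul z w X := by
    simp only [smul_def, AddEquiv.symm_apply_apply]
    refine congrArg h.toMJ ?_
    simp only [map_add, map_smul, J_sq, Complex.mul_re, Complex.mul_im]
    module
  smul_zero z := by simp [smul_def]
  smul_add z X Y := by
    simp only [smul_def, ← map_add]
    congr 1
    simp only [map_add]
    module
  add_smul z w X := by
    simp only [smul_def, ← map_add]
    congr 1
    simp only [Complex.add_re, Complex.add_im]
    module
  zero_smul X := by simp [smul_def]

instance [Module.Finite ℝ M] : Module.Finite ℂ h.MJ := by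
  obtain ⟨s, hs⟩ := (inferInstance : Module.Finite ℝ M).fg_top
  classical
  refine ⟨⟨s.image h.toMJ, ?_⟩⟩
  rw [eq_top_iff]
  rintro X -
  have hX : h.toMJ.symm X ∈ Submodule.span ℝ (s : Set M) := hs ▸ Submodule.mem_top
  have : ∀ Y ∈ Submodule.span ℝ (s : Set M),
      h.toMJ Y ∈ Submodule.span ℂ ((s.image h.toMJ : Finset h.MJ) : Set h.MJ) := by
    intro Y hY
    induction hY using Submodule.span_induction with
    | mem Y hY => exact Submodule.subset_span (by
      rw [Finset.coe_image]; exact ⟨Y, hY, rfl⟩)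
    | zero => simp
    | add a b _ _ ha hb => rw [map_add]; exact add_mem ha hb
    | smul c a _ ha =>
      have : h.toMJ (c • a) = (c : ℂ) • h.toMJ a := by
        rw [smul_def]; simp
      rw [this]
      exact Submodule.smul_mem _ _ ha
  simpa using this _ hX

/-- A real-linear endomorphism of `M` which commutes with `J`, as a complex-linear endomorphism
of `M_J`. -/
def complexify (l : M →ₗ[ℝ] M) (hl : ∀ X, l (h.J X) = h.J (l X)) : h.MJ →ₗ[ℂ] h.MJ where
  toFun X := h.toMJ (l (h.toMJ.symm X))
  map_add' X Y := by simp
  map_smul' z X := by simp [smul_def, hl]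

/-- The complex inner product `⟨X, Y⟩_J = g (X, Y) + i g (J X, Y)` on `M_J`, linear in the second
variable, as a linear functional of `Y`. -/
def herm (X : M) : Module.Dual ℂ h.MJ where
  toFun Y := h.g X (h.toMJ.symm Y) + Complex.I * h.g (h.J X) (h.toMJ.symm Y)
  map_add' Y Z := by simp; ring
  map_smul' z Y := by
    have h1 : ∀ Y, h.g X (h.J Y) = -h.g (h.J X) Y := fun Y => by
      rw [← h.J_orth X, h.J_sq, map_neg]
    apply Complex.ext <;> simp [smul_def, h1, h.J_orth] <;> ring

/-- The space of spinors: the complex exterior algebra of `M_J`. -/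
abbrev Spinor : Type _ := ExteriorAlgebra ℂ h.MJ

instance [Module.Finite ℝ M] : Module.Finite ℂ h.Spinor :=
  Module.Finite.of_basis (Module.finBasis ℂ h.MJ).ExteriorAlgebra

/-- The annihilation operator
`a(X) (X₁ ∧ … ∧ Xₚ) = ∑ⱼ (-1)ʲ⁻¹ ⟨X, Xⱼ⟩_J X₁ ∧ … ∧ X̂ⱼ ∧ … ∧ Xₚ`. -/
def annihilation (X : M) : h.Spinor →ₗ[ℂ] h.Spinor :=
  CliffordAlgebra.contractLeft (Q := (0 : QuadraticForm ℂ h.MJ)) (h.herm X)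

/-- The creation operator `a†(X) (X₁ ∧ … ∧ Xₚ) = X ∧ X₁ ∧ … ∧ Xₚ`. -/
def creation (X : M) : h.Spinor →ₗ[ℂ] h.Spinor :=
  LinearMap.mulLeft ℂ (ExteriorAlgebra.ι ℂ (h.toMJ X))

/-- The action `κ (X) = i (a(X) + a†(X))` of vectors on spinors. -/
def clifford (X : M) : h.Spinor →ₗ[ℂ] h.Spinor :=
  Complex.I • (h.annihilation X + h.creation X)

theorem herm_add (X Y : M) : h.herm (X + Y) = h.herm X + h.herm Y := by
  ext Z; simp [herm]; ring

theorem herm_smul (z : ℂ) (X : h.MJ) :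
    h.herm (h.toMJ.symm (z • X)) = (starRingEnd ℂ z) • h.herm (h.toMJ.symm X) := by
  ext Z
  apply Complex.ext <;> simp [herm, smul_def, h.J_sq]

theorem herm_symm (X Y : M) :
    starRingEnd ℂ (h.herm X (h.toMJ Y)) = h.herm Y (h.toMJ X) := by
  have h1 : h.g (h.J Y) X = -h.g (h.J X) Y := by
    rw [← h.J_orth, h.J_sq, map_neg, LinearMap.neg_apply, h.symm]
  apply Complex.ext
  · simp [herm, h.symm X Y]
  · simp [herm, h1]

/-- The step of the recursion which defines the inner product of spinors: a conjugate-linear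
functional `θ` is sent to `ψ ↦ θ (a(Y) ψ)`. -/
def innerStep : h.MJ →ₗ[ℂ] (h.Spinor →ₛₗ[starRingEnd ℂ] ℂ) →ₗ[ℂ]
    (h.Spinor →ₛₗ[starRingEnd ℂ] ℂ) :=
  LinearMap.mk₂ ℂ (fun Y θ => θ.comp (h.annihilation (h.toMJ.symm Y)))
    (fun Y Z θ => by ext ψ; simp [annihilation, herm_add])
    (fun z Y θ => by ext ψ; simp [annihilation, herm_smul])
    (fun Y θ η => by ext ψ; simp)
    (fun z Y θ => by ext ψ; simp)

theorem innerStep_innerStep (Y : h.MJ) (θ : h.Spinor →ₛₗ[starRingEnd ℂ] ℂ) :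
    h.innerStep Y (h.innerStep Y θ) = (0 : QuadraticForm ℂ h.MJ) Y • θ := by
  ext ψ
  simp [innerStep, annihilation, CliffordAlgebra.contractLeft_contractLeft]

/-- The conjugate of the scalar component of a spinor. -/
def innerBase : h.Spinor →ₛₗ[starRingEnd ℂ] ℂ where
  toFun ψ := starRingEnd ℂ (ExteriorAlgebra.algebraMapInv ψ)
  map_add' ψ φ := by simp
  map_smul' z ψ := by simp

/-- The inner product of spinors, conjugate-linear in the first and linear in the second variable,
determined by `⟨ψ, 1⟩ = conj ψ₀` (`ψ₀` the scalar component of `ψ`) and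
`⟨ψ, Y ∧ φ⟩ = ⟨a(Y) ψ, φ⟩`. The next two theorems show that this is the inner product with
`⟨X₁ ∧ … ∧ Xₚ, Y₁ ∧ … ∧ Y_q⟩ = δ_{pq} det [⟨X_k, Y_l⟩_J]`. -/
def spinInner (ψ φ : h.Spinor) : ℂ :=
  CliffordAlgebra.foldr (0 : QuadraticForm ℂ h.MJ) h.innerStep h.innerStep_innerStep h.innerBase φ ψ

theorem spinInner_one (ψ : h.Spinor) :
    h.spinInner ψ 1 = starRingEnd ℂ (ExteriorAlgebra.algebraMapInv ψ) := by
  simp [spinInner]; rfl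

theorem spinInner_ι_mul (ψ φ : h.Spinor) (Y : M) :
    h.spinInner ψ (ExteriorAlgebra.ι ℂ (h.toMJ Y) * φ) = h.spinInner (h.annihilation Y ψ) φ := by
  simp only [spinInner]
  erw [CliffordAlgebra.foldr_mul, CliffordAlgebra.foldr_ι]
  rfl

theorem spinInner_sum {α : Type*} (s : Finset α) (c : α → ℂ) (ψ : α → h.Spinor) (φ : h.Spinor) :
    h.spinInner (∑ i ∈ s, c i • ψ i) φ = ∑ i ∈ s, starRingEnd ℂ (c i) * h.spinInner (ψ i) φ := by
  simp [spinInner, map_sum]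

theorem annihilation_ιMulti (X : M) : ∀ {p : ℕ} (Z : Fin (p + 1) → h.MJ),
    h.annihilation X (ExteriorAlgebra.ιMulti ℂ (p + 1) Z) =
      ∑ j : Fin (p + 1), ((-1) ^ (j : ℕ) * h.herm X (Z j)) •
        ExteriorAlgebra.ιMulti ℂ p (Z ∘ j.succAbove) := by
  intro p
  induction p with
  | zero =>
    intro Z
    simp [annihilation, CliffordAlgebra.contractLeft_ι, Algebra.algebraMap_eq_smul_one]
  | succ p ih =>
    intro Z
    have h1 : h.annihilation X (ExteriorAlgebra.ι ℂ (Z 0) *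
        ExteriorAlgebra.ιMulti ℂ (p + 1) (Matrix.vecTail Z)) =
        h.herm X (Z 0) • ExteriorAlgebra.ιMulti ℂ (p + 1) (Matrix.vecTail Z) -
        ExteriorAlgebra.ι ℂ (Z 0) *
          h.annihilation X (ExteriorAlgebra.ιMulti ℂ (p + 1) (Matrix.vecTail Z)) :=
      CliffordAlgebra.contractLeft_ι_mul ..
    rw [ExteriorAlgebra.ιMulti_succ_apply, h1, ih, Finset.mul_sum, Fin.sum_univ_succ (n := p + 1), sub_eq_add_neg,
      ← Finset.sum_neg_distrib]
    congr 1
    · simp [Fin.succAbove_zero]; rfl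
    · refine Finset.sum_congr rfl fun j _ => ?_
      rw [ExteriorAlgebra.ιMulti_succ_apply (v := Z ∘ j.succ.succAbove), mul_smul_comm, ← neg_smul]
      have e1 : (Z ∘ j.succ.succAbove) 0 = Z 0 := by simp
      have e2 : Matrix.vecTail (Z ∘ j.succ.succAbove) = Matrix.vecTail Z ∘ j.succAbove := by
        funext k; simp [Matrix.vecTail]
      rw [e1, e2]
      congr 1
      simp [Matrix.vecTail, pow_succ]

theorem spinInner_ιMulti : ∀ {p : ℕ} (X Y : Fin p → h.MJ),
    h.spinInner (ExteriorAlgebra.ιMulti ℂ p X) (ExteriorAlgebra.ιMulti ℂ p Y) =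
      (Matrix.of fun k l => h.herm (h.toMJ.symm (X k)) (Y l)).det := by
  intro p
  induction p with
  | zero => intro X Y; simp [spinInner_one]
  | succ p ih =>
    intro X Y
    rw [ExteriorAlgebra.ιMulti_succ_apply (v := Y), Matrix.det_succ_column_zero]
    have := h.spinInner_ι_mul (ExteriorAlgebra.ιMulti ℂ (p + 1) X)
      (ExteriorAlgebra.ιMulti ℂ p (Matrix.vecTail Y)) (h.toMJ.symm (Y 0))
    rw [AddEquiv.apply_symm_apply] at this
    rw [this, annihilation_ιMulti, spinInner_sum]
    refine Finset.sum_congr rfl fun j _ => ?_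
    have hj : starRingEnd ℂ (h.herm (h.toMJ.symm (Y 0)) (X j)) =
        h.herm (h.toMJ.symm (X j)) (Y 0) :=
      h.herm_symm (h.toMJ.symm (Y 0)) (h.toMJ.symm (X j))
    rw [ih, map_mul, hj, map_pow, map_neg, map_one]
    rfl

theorem spinInner_ιMulti_of_ne : ∀ {q p : ℕ} (_ : p ≠ q) (X : Fin p → h.MJ) (Y : Fin q → h.MJ),
    h.spinInner (ExteriorAlgebra.ιMulti ℂ p X) (ExteriorAlgebra.ιMulti ℂ q Y) = 0 := by
  intro q
  induction q with
  | zero =>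
    intro p hp X Y
    obtain ⟨p, rfl⟩ := Nat.exists_eq_succ_of_ne_zero hp
    rw [ExteriorAlgebra.ιMulti_zero_apply, spinInner_one, ExteriorAlgebra.ιMulti_succ_apply, map_mul]
    simp [ExteriorAlgebra.algebraMapInv]
  | succ q ih =>
    intro p hp X Y
    have := h.spinInner_ι_mul (ExteriorAlgebra.ιMulti ℂ p X)
      (ExteriorAlgebra.ιMulti ℂ q (Matrix.vecTail Y)) (h.toMJ.symm (Y 0))
    rw [AddEquiv.apply_symm_apply] at this
    rw [ExteriorAlgebra.ιMulti_succ_apply, this]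
    cases p with
    | zero =>
      have h0 : h.annihilation (h.toMJ.symm (Y 0)) (ExteriorAlgebra.ιMulti ℂ 0 X) = 0 := by
        rw [ExteriorAlgebra.ιMulti_zero_apply]
        exact CliffordAlgebra.contractLeft_one (Q := (0 : QuadraticForm ℂ h.MJ)) _
      rw [h0]
      simp [spinInner]
    | succ p =>
      rw [annihilation_ιMulti, spinInner_sum]
      refine Finset.sum_eq_zero fun j _ => ?_
      rw [ih (by omega), mul_zero]

section Derivation

variable [Module.Finite ℝ M]

/-- The extension of a complex-linear endomorphism `l` of `M_J` to a derivation of the exterior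
algebra: `X₁ ∧ … ∧ Xₚ ↦ ∑ⱼ X₁ ∧ … ∧ l (Xⱼ) ∧ … ∧ Xₚ`. It is written as `∑ᵢ a†(l bᵢ) ∘ bᵢ*` for
a basis `b`; the next two theorems are the derivation property on generators. -/
def extDer (l : h.MJ →ₗ[ℂ] h.MJ) : h.Spinor →ₗ[ℂ] h.Spinor :=
  ∑ i, LinearMap.mulLeft ℂ (ExteriorAlgebra.ι ℂ (l (Module.finBasis ℂ h.MJ i))) ∘ₗ
    CliffordAlgebra.contractLeft (Q := (0 : QuadraticForm ℂ h.MJ))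
      ((Module.finBasis ℂ h.MJ).coord i)

theorem extDer_one (l : h.MJ →ₗ[ℂ] h.MJ) : h.extDer l 1 = 0 := by
  simp [extDer, CliffordAlgebra.contractLeft_one]

theorem extDer_ι_mul (l : h.MJ →ₗ[ℂ] h.MJ) (X : h.MJ) (ψ : h.Spinor) :
    h.extDer l (ExteriorAlgebra.ι ℂ X * ψ) =
      ExteriorAlgebra.ι ℂ (l X) * ψ + ExteriorAlgebra.ι ℂ X * h.extDer l ψ := by
  set b := Module.finBasis ℂ h.MJ with hb
  have hX : l X = ∑ i, b.coord i X • l (b i) := by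
    conv_lhs => rw [← b.sum_repr X, map_sum]
    simp only [map_smul, Module.Basis.coord_apply]
  have key : ∀ i, CliffordAlgebra.contractLeft (Q := (0 : QuadraticForm ℂ h.MJ)) (b.coord i)
      (ExteriorAlgebra.ι ℂ X * ψ) = b.coord i X • ψ - ExteriorAlgebra.ι ℂ X *
        CliffordAlgebra.contractLeft (Q := (0 : QuadraticForm ℂ h.MJ)) (b.coord i) ψ := fun i =>
    CliffordAlgebra.contractLeft_ι_mul ..
  have anti : ∀ (Y Z : h.MJ) (φ : h.Spinor), ExteriorAlgebra.ι ℂ Y * (ExteriorAlgebra.ι ℂ Z * φ) =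
      -(ExteriorAlgebra.ι ℂ Z * (ExteriorAlgebra.ι ℂ Y * φ)) := by
    intro Y Z φ
    rw [eq_neg_iff_add_eq_zero, ← mul_assoc, ← mul_assoc, ← add_mul,
      ExteriorAlgebra.ι_add_mul_swap (R := ℂ) Y Z, zero_mul]
  simp only [extDer, LinearMap.sum_apply, LinearMap.comp_apply, LinearMap.mulLeft_apply, ← hb]
  rw [hX, map_sum, Finset.sum_mul, Finset.mul_sum, ← Finset.sum_add_distrib]
  refine Finset.sum_congr rfl fun i _ => ?_
  rw [key, mul_sub, anti, sub_neg_eq_add, map_smul, mul_smul_comm, smul_mul_assoc]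

end Derivation

end HermSpace

end Spinors
section Group

variable {E : Type*} [NormedAddCommGroup E] [NormedSpace ℝ E] [FiniteDimensional ℝ E]
  {H : Type*} [TopologicalSpace H] (I : ModelWithCorners ℝ E H)
  {G : Type*} [TopologicalSpace G] [ChartedSpace H G] [Group G]

instance lieGroupMinSmoothness [LieGroup I ∞ G] : LieGroup I (minSmoothness ℝ 3) G := by
  rw [minSmoothness_of_isRCLikeNormedField]
  infer_instance

instance finiteDimensionalLieAlg : FiniteDimensional ℝ (GroupLieAlgebra I G) :=
  inferInstanceAs (FiniteDimensional ℝ E)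

/-- Conjugation `z ↦ x z x⁻¹`. -/
def conj (x : G) (z : G) : G := x * z * x⁻¹

/-- The derivative at the identity of conjugation by `x`, on the model space `E` which underlies the
Lie algebra of `G`. -/
def AdL (x : G) : E →L[ℝ] E := mfderiv I I (conj x) (1 : G)

/-- The adjoint action: `Ad x` is the derivative at the identity of conjugation by `x`. -/
def Ad (x : G) : GroupLieAlgebra I G →ₗ[ℝ] GroupLieAlgebra I G := (AdL I x).toLinearMap

variable [LieGroup I ∞ G]

theorem conj_one (x : G) : conj x 1 = 1 := by simp [conj]

theorem contMDiff_conj (x : G) : ContMDiff I I ∞ (conj x) := by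
  exact (contMDiff_const.mul contMDiff_id).mul contMDiff_const

theorem mdiff_conj (x z : G) : MDifferentiableAt I I (conj x) z :=
  (contMDiff_conj I x).mdifferentiableAt (by simp)

theorem Ad_one : Ad I (1 : G) = LinearMap.id := by
  have : conj (1 : G) = id := by ext z; simp [conj]
  unfold Ad AdL
  rw [this, mfderiv_id]
  rfl

theorem mfderiv_conj_congr (x z : G) (hz : z = 1) (v : E) :
    (show E →L[ℝ] E from mfderiv I I (conj x) z) v =
      AdL I x v := by
  subst hz; rfl

theorem Ad_mul (x y : G) (v : GroupLieAlgebra I G) : Ad I (x * y) v = Ad I x (Ad I y v) := by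
  have h : conj (x * y) = conj x ∘ conj y := by ext z; simp [conj, mul_assoc]
  have := mfderiv_comp (I := I) (I' := I) (I'' := I) (1 : G) (mdiff_conj I x (conj y 1))
    (mdiff_conj I y 1)
  rw [← h] at this
  have h2 := DFunLike.congr_fun this v
  exact h2.trans (mfderiv_conj_congr I x (conj y 1) (conj_one y) _)

theorem Ad_inv_apply (x : G) (v : GroupLieAlgebra I G) : Ad I x⁻¹ (Ad I x v) = v := by
  rw [← Ad_mul, inv_mul_cancel, Ad_one]; rfl

theorem Ad_apply_inv (x : G) (v : GroupLieAlgebra I G) : Ad I x (Ad I x⁻¹ v) = v := by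
  rw [← Ad_mul, mul_inv_cancel, Ad_one]; rfl

theorem isInvertible_mfderiv_conj (x h : G) : (mfderiv I I (conj x) h).IsInvertible := by
  have hc : conj x⁻¹ ∘ conj x = (id : G → G) := by ext z; simp [conj, mul_assoc]
  have hc' : conj x ∘ conj x⁻¹ = (id : G → G) := by ext z; simp [conj, mul_assoc]
  have e1 := mfderiv_comp (I := I) (I' := I) (I'' := I) h (mdiff_conj I x⁻¹ (conj x h))
    (mdiff_conj I x h)
  rw [hc, mfderiv_id] at e1
  have e2 := mfderiv_comp (I := I) (I' := I) (I'' := I) (conj x h)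
    (mdiff_conj I x (conj x⁻¹ (conj x h))) (mdiff_conj I x⁻¹ (conj x h))
  rw [hc', mfderiv_id] at e2
  have hh : conj x⁻¹ (conj x h) = h := congrFun hc h
  rw [hh] at e2
  exact ContinuousLinearMap.IsInvertible.of_inverse e2.symm e1.symm

theorem mpullback_conj (x : G) (v : GroupLieAlgebra I G) :
    VectorField.mpullback I I (conj x) (mulInvariantVectorField (Ad I x v)) =
      mulInvariantVectorField v := by
  ext h
  have key : (mulInvariantVectorField (Ad I x v) : ∀ g : G, TangentSpace I g) (conj x h) =
      mfderiv I I (conj x) h (mulInvariantVectorField v h) := by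
    have hL : ∀ g z : G, MDifferentiableAt I I (g * ·) z := fun g z =>
      ((contMDiff_mul_left (I := I) (n := ∞) (a := g)).mdifferentiableAt (by simp))
    have hc : (conj x h * ·) ∘ conj x = conj x ∘ (h * ·) := by
      ext z; simp [conj, mul_assoc]
    have e1 := mfderiv_comp (I := I) (I' := I) (I'' := I) (1 : G) (hL (conj x h) (conj x 1))
      (mdiff_conj I x 1)
    have e2 := mfderiv_comp (I := I) (I' := I) (I'' := I) (1 : G) (mdiff_conj I x (h * 1))
      (hL h 1)
    have aux1 : ∀ (z : G) (_ : z = 1) (w : E),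
        (show E →L[ℝ] E from mfderiv I I (conj x h * ·) z) w =
        (show E →L[ℝ] E from mfderiv I I (conj x h * ·) (1 : G)) w := by
      rintro z rfl w; rfl
    have aux2 : ∀ (z : G) (_ : z = h) (w : E),
        (show E →L[ℝ] E from mfderiv I I (conj x) z) w =
        (show E →L[ℝ] E from mfderiv I I (conj x) h) w := by
      rintro z rfl w; rfl
    rw [hc] at e1
    have e3 := (DFunLike.congr_fun e1 v).symm.trans (DFunLike.congr_fun e2 v)
    exact (aux1 _ (conj_one x) _).symm.trans (e3.trans (aux2 _ (mul_one h) _))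
  rw [VectorField.mpullback_apply, key]
  exact (isInvertible_mfderiv_conj I x h).inverse_apply_eq.2 rfl

theorem Ad_lie (x : G) (v w : GroupLieAlgebra I G) : Ad I x ⁅v, w⁆ = ⁅Ad I x v, Ad I x w⁆ := by
  have h := VectorField.mpullback_mlieBracket (I := I) (I' := I) (n := minSmoothness ℝ 3) (f := conj x) (x₀ := (1 : G))
    (mdifferentiableAt_mulInvariantVectorField (I := I) (Ad I x v) (g := conj x 1))
    (mdifferentiableAt_mulInvariantVectorField (I := I) (Ad I x w) (g := conj x 1))
    (by
      rw [minSmoothness_of_isRCLikeNormedField]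
      exact (contMDiff_conj I x).contMDiffAt.of_le ENat.LEInfty.out)
    (minSmoothness_monotone (by norm_cast))
  rw [mpullback_conj, mpullback_conj, VectorField.mpullback_apply,
    (isInvertible_mfderiv_conj I x 1).inverse_apply_eq] at h
  have aux : ∀ (z : G) (_ : z = 1),
      (VectorField.mlieBracket I (mulInvariantVectorField (Ad I x v))
        (mulInvariantVectorField (Ad I x w)) z : E) =
      (VectorField.mlieBracket I (mulInvariantVectorField (Ad I x v))
        (mulInvariantVectorField (Ad I x w)) (1 : G) : E) := by
    rintro z rfl; rfl
  exact h.symm.trans (aux _ (conj_one x))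

/-- The adjoint action as a Lie algebra automorphism. -/
def AdEquiv (x : G) : GroupLieAlgebra I G ≃ₗ⁅ℝ⁆ GroupLieAlgebra I G :=
  { Ad I x with
    map_lie' := fun {v w} => Ad_lie I x v w
    invFun := Ad I x⁻¹
    left_inv := Ad_inv_apply I x
    right_inv := Ad_apply_inv I x }

variable (G) in
/-- `Kil`, the negative of the Killing form of the Lie algebra of `G`. -/
def Kil : LinearMap.BilinForm ℝ (GroupLieAlgebra I G) := -killingForm ℝ (GroupLieAlgebra I G)

theorem Kil_Ad (x : G) (v w : GroupLieAlgebra I G) :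
    Kil I G (Ad I x v) (Ad I x w) = Kil I G v w := by
  have := LieAlgebra.killingForm_of_equiv_apply (R := ℝ) (AdEquiv I x) v w
  simp only [Kil, LinearMap.neg_apply]
  exact congrArg Neg.neg this

theorem Kil_Ad_left (x : G) (v w : GroupLieAlgebra I G) :
    Kil I G v (Ad I x w) = Kil I G (Ad I x⁻¹ v) w := by
  rw [← Kil_Ad I x⁻¹ v, Ad_inv_apply]

/-- `γ` is the one-parameter subgroup `t ↦ exp (t X)` of `G`. -/
def IsOneParameterSubgroup (γ : ℝ → G) (X : GroupLieAlgebra I G) : Prop :=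
  γ 0 = 1 ∧ (∀ s t, γ (s + t) = γ s * γ t) ∧
    HasMFDerivAt 𝓘(ℝ, ℝ) I γ 0 (ContinuousLinearMap.toSpanSingleton ℝ (X : E))

variable (K : Subgroup G)

/-- The Lie algebra of the closed subgroup `K`: the tangent vectors `X` with `exp (t X) ∈ K` for all
`t`. (For closed `K` this set of vectors is already a subspace.) -/
def lieK : Submodule ℝ (GroupLieAlgebra I G) :=
  Submodule.span ℝ {X | ∃ γ : ℝ → G, IsOneParameterSubgroup I γ X ∧ ∀ t, γ t ∈ K}

/-- `𝔪`, the orthogonal complement of the Lie algebra of `K` with respect to `Kil`. -/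
def mm : Submodule ℝ (GroupLieAlgebra I G) where
  carrier := {Y | ∀ X ∈ lieK I K, Kil I G X Y = 0}
  add_mem' := fun {a b} ha hb X hX => by rw [map_add, ha X hX, hb X hX, add_zero]
  zero_mem' := fun X _ => map_zero _
  smul_mem' := fun c a ha X hX => by rw [map_smul, ha X hX, smul_zero]

theorem Ad_mem_lieK {s : G} (hs : s ∈ K) {X : GroupLieAlgebra I G} (hX : X ∈ lieK I K) :
    Ad I s X ∈ lieK I K := by
  induction hX using Submodule.span_induction with
  | mem X hX =>
    obtain ⟨γ, ⟨h0, hadd, hd⟩, hK⟩ := hX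
    refine Submodule.subset_span ⟨fun t => conj s (γ t), ⟨?_, ?_, ?_⟩, ?_⟩
    · simp [h0, conj]
    · intro a b; simp [hadd, conj, mul_assoc]
    · have := (mdiff_conj I s (γ 0)).hasMFDerivAt.comp 0 hd
      refine this.congr_mfderiv ?_
      have h1 := mfderiv_conj_congr I s (γ 0) h0 X
      ext
      change (show E →L[ℝ] E from mfderiv I I (conj s) (γ 0)) ((1 : ℝ) • (X : E)) =
        (1 : ℝ) • (Ad I s X : E)
      rw [one_smul, one_smul]
      exact h1
    · intro t; exact K.mul_mem (K.mul_mem hs (hK t)) (K.inv_mem hs)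
  | zero => rw [map_zero]; exact zero_mem _
  | add a b _ _ ha hb => rw [map_add]; exact add_mem ha hb
  | smul c a _ ha => rw [map_smul]; exact Submodule.smul_mem _ _ ha

theorem Ad_mem_mm {s : G} (hs : s ∈ K) {Y : GroupLieAlgebra I G} (hY : Y ∈ mm I K) :
    Ad I s Y ∈ mm I K := fun X hX => by
  rw [Kil_Ad_left]
  exact hY _ (Ad_mem_lieK I K (K.inv_mem hs) hX)

/-- The adjoint action of `K` on `𝔪`. -/
def AdK (s : K) : mm I K →ₗ[ℝ] mm I K :=
  (Ad I (s : G)).restrict fun _ hY => Ad_mem_mm I K s.2 hY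

open Classical in
/-- The projection `P` of the Lie algebra of `G` onto `𝔪` along the Lie algebra of `K`. (The two are
complementary when `G` is compact and semisimple, since then `Kil` is definite.) -/
def projm : GroupLieAlgebra I G →ₗ[ℝ] mm I K :=
  if h : IsCompl (mm I K) (lieK I K) then (mm I K).projectionOnto (lieK I K) h else 0

theorem projm_Ad (s : K) (X : GroupLieAlgebra I G) :
    projm I K (Ad I (s : G) X) = AdK I K s (projm I K X) := by
  unfold projm
  split_ifs with h
  · have hX := Submodule.projection_add_projection_eq_self h X
    set a := (mm I K).projectionOnto (lieK I K) h X with ha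
    have h1 : X - a ∈ lieK I K := Submodule.sub_projection_mem h X
    have h2 : X = (a : GroupLieAlgebra I G) + (X - a) := by abel
    conv_lhs => rw [h2]
    rw [map_add, map_add, (Submodule.projectionOnto_apply_eq_zero_iff h).2
      (Ad_mem_lieK I K s.2 h1), add_zero]
    exact Submodule.projectionOnto_apply_left h (AdK I K s a)
  · simp


theorem contMDiff_Ad (X : GroupLieAlgebra I G) :
    ContMDiff I 𝓘(ℝ, E) ∞ (fun y : G => AdL I y X) := by
  intro x
  have hconj : ContMDiffAt (I.prod I) I ∞ (Function.uncurry (conj : G → G → G)) (x, 1) := by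
    have : ContMDiff (I.prod I) I ∞ (fun p : G × G => p.1 * p.2 * p.1⁻¹) :=
      (contMDiff_fst.mul contMDiff_snd).mul contMDiff_fst.inv
    exact this.contMDiffAt
  have h := ContMDiffAt.mfderiv (I := I) (I' := I) (J := I) (m := ∞) (n := ∞)
    (conj : G → G → G) (fun _ : G => (1 : G)) hconj contMDiffAt_const (by simp)
  have heq : ∀ y : G, inTangentCoordinates I I (fun _ : G => (1 : G)) (fun y : G => conj y 1)
      (AdL I) x y = AdL I y := by
    intro y
    have hb : ∀ z : G, z = 1 → ∀ w : G, w = 1 → ∀ v : E,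
        (tangentBundleCore I G).coordChange (achart H z) (achart H w) z v = v := by
      rintro z rfl w rfl v
      exact (tangentBundleCore I G).coordChange_self _ _ (mem_chart_source H _) _
    refine (inTangentCoordinates_eq (I := I) (I' := I) (fun _ : G => (1 : G))
      (fun y : G => conj y 1) (AdL I) (x₀ := x) (x := y) (mem_chart_source H _)
      (by simp only [conj_one]; exact mem_chart_source H _)).trans ?_
    ext v
    simp only [ContinuousLinearMap.comp_apply]
    rw [hb _ (conj_one y) _ (conj_one x), hb 1 rfl 1 rfl]
  have h' : ContMDiffAt I 𝓘(ℝ, E →L[ℝ] E) ∞ (AdL I : G → E →L[ℝ] E) x :=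
    h.congr_of_eventuallyEq (Filter.Eventually.of_forall fun y => (heq y).symm)
  exact h'.clm_apply contMDiffAt_const

/-! ### Smooth functions, vector fields and directional derivatives -/

/-- Smoothness of a function on `G` with values in a finite-dimensional real vector space: all its
components are smooth. -/
def SmoothTo {F : Type*} [AddCommGroup F] [Module ℝ F] (f : G → F) : Prop :=
  ∀ l : F →ₗ[ℝ] ℝ, ContMDiff I 𝓘(ℝ, ℝ) ∞ fun x => l (f x)

/-- The derivative at `t = 0` of `t ↦ f (x exp (t X))`, that is, the derivative of `f` at `x` along
the left-invariant vector field of `X`. -/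
def dirDeriv (f : G → ℝ) (x : G) (X : GroupLieAlgebra I G) : ℝ :=
  mfderiv I 𝓘(ℝ, ℝ) f x (mulInvariantVectorField X x)

/-- The derivative at `t = 0` of `t ↦ f (x exp (t X))` for a function `f` with values in a
finite-dimensional real vector space, computed componentwise. -/
def vecDeriv {F : Type*} [AddCommGroup F] [Module ℝ F] [Module.Finite ℝ F] (f : G → F) (x : G)
    (X : GroupLieAlgebra I G) : F :=
  ∑ i, dirDeriv I (fun y => (Module.finBasis ℝ F).coord i (f y)) x X • Module.finBasis ℝ F i

/-- The algebra `A` of smooth real functions on `G / K`, viewed as functions on `G`. -/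
def smoothFun : Subalgebra ℝ (G → ℝ) where
  carrier := {f | ContMDiff I 𝓘(ℝ, ℝ) ∞ f ∧ ∀ (x : G) (s : K), f (x * s) = f x}
  mul_mem' := fun {f g} hf hg => ⟨hf.1.mul hg.1, fun x s => by simp [hf.2, hg.2]⟩
  add_mem' := fun {f g} hf hg => ⟨hf.1.add hg.1, fun x s => by simp [hf.2, hg.2]⟩
  algebraMap_mem' := fun r => ⟨contMDiff_const, fun _ _ => rfl⟩

/-- The space of (tangent) vector fields on `G / K`. -/
def vectorField : Submodule ℝ (G → mm I K) where
  carrier := {V | SmoothTo I V ∧ ∀ (x : G) (s : K), V (x * s) = AdK I K s⁻¹ (V x)}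
  add_mem' := fun {V W} hV hW => by
    refine ⟨fun l => ?_, fun x s => by simp [hV.2, hW.2]⟩
    have := (hV.1 l).add (hW.1 l)
    convert this using 2 with x
    exact l.map_add (V x) (W x)
  zero_mem' := ⟨fun l => by simpa using contMDiff_const, fun x s => by simp⟩
  smul_mem' := fun c V hV => by
    refine ⟨fun l => ?_, fun x s => by simp [hV.2]⟩
    have := (contMDiff_const (c := c)).mul (hV.1 l)
    convert this using 2 with x
    exact l.map_smul c (V x)

/-- The product of a smooth function and a vector field, which makes the vector fields an
`A`-module. -/
def mulField (f : smoothFun I K) (V : vectorField I K) : vectorField I K :=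
  ⟨fun x => f.1 x • V.1 x, fun l => by
    have := f.2.1.mul (V.2.1 l)
    convert this using 2 with x
    exact l.map_smul (f.1 x) (V.1 x), fun x s => by
    change f.1 (x * s) • V.1 (x * s) = AdK I K s⁻¹ (f.1 x • V.1 x)
    rw [f.2.2 x s, V.2.2 x s, map_smul]⟩

/-- The action of `G` on vector fields by translation. -/
def translate (a : G) (V : vectorField I K) : vectorField I K :=
  ⟨fun x => V.1 (a⁻¹ * x), fun l => (V.2.1 l).comp contMDiff_mul_left, fun x s => by
    change V.1 (a⁻¹ * (x * s)) = _
    rw [← mul_assoc]; exact V.2.2 _ s⟩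

/-- The fundamental vector field `X̂ (x) = - P Ad_x⁻¹ X`. -/
def fundField (X : GroupLieAlgebra I G) : vectorField I K :=
  ⟨fun x => -projm I K (Ad I x⁻¹ X), by
    intro l
    have h1 : ContMDiff I 𝓘(ℝ, E) ∞ fun x : G => AdL I x⁻¹ X :=
      (contMDiff_Ad I X).comp (contMDiff_inv I ∞)
    let L : E →ₗ[ℝ] ℝ := l.comp (-(projm I K))
    have h2 : ContMDiff I 𝓘(ℝ, ℝ) ∞ fun x : G => L.toContinuousLinearMap (AdL I x⁻¹ X) :=
      L.toContinuousLinearMap.contMDiff.comp h1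
    exact h2, by
    intro x s
    change -projm I K (Ad I (x * s)⁻¹ X) = AdK I K s⁻¹ (-projm I K (Ad I x⁻¹ X))
    rw [mul_inv_rev, Ad_mul]
    have := projm_Ad I K s⁻¹ (Ad I x⁻¹ X)
    rw [InvMemClass.coe_inv] at this
    rw [this, map_neg]⟩

/-- A vector field whose value at `x` is `w`, namely the fundamental vector field of `- Ad_x w`. -/
def extendField (x : G) (w : mm I K) : vectorField I K :=
  fundField I K (-(Ad I x (w : GroupLieAlgebra I G)))

/-- The canonical connection: `(∇ᶜ_V W) (x)` is the derivative at `t = 0` of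
`t ↦ W (x exp (t V(x)))`. -/
def canonical (V W : vectorField I K) (x : G) : mm I K :=
  vecDeriv I W.1 x (V.1 x : GroupLieAlgebra I G)

/-- A connection on the module of vector fields of `G / K`. -/
structure Connection where
  /-- `∇_V W`. -/
  toFun : vectorField I K → vectorField I K → vectorField I K
  add_left : ∀ U V W, toFun (U + V) W = toFun U W + toFun V W
  smul_left : ∀ (f : smoothFun I K) V W, toFun (mulField I K f V) W = mulField I K f (toFun V W)
  add_right : ∀ U V W, toFun U (V + W) = toFun U V + toFun U W
  leibniz : ∀ (f : smoothFun I K) V W (x : G), (toFun V (mulField I K f W)).1 x =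
    f.1 x • (toFun V W).1 x + dirDeriv I f.1 x (V.1 x : GroupLieAlgebra I G) • W.1 x

variable {I K}

/-- Invariance of a connection under translation by `G`. -/
def Connection.IsInvariant (D : Connection I K) : Prop :=
  ∀ (a : G) (V W : vectorField I K),
    D.toFun (translate I K a V) (translate I K a W) = translate I K a (D.toFun V W)

/-- `(L_V W) (x)` for `L = ∇ - ∇ᶜ`. -/
def Connection.diff (D : Connection I K) (V W : vectorField I K) (x : G) : mm I K :=
  (D.toFun V W).1 x - canonical I K V W x

/-- The endomorphism `L_V (x)` of `𝔪`, determined by `(L_V W) (x) = L_V (x) (W (x))`: it sends `w` to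
the value at `x` of `L_V W` for a vector field `W` with `W (x) = w`. -/
def Connection.diffEnd (D : Connection I K) (V : vectorField I K) (x : G) (w : mm I K) : mm I K :=
  D.diff V (extendField I K x w) x

variable (I K)

/-- An almost-Hermitian structure on `G / K`: an inner product `g` on `𝔪` and a complex structure `J`
on `𝔪` orthogonal for `g`, both invariant for the adjoint action of `K`. -/
structure AlmostHermitian extends HermSpace (mm I K) where
  g_Ad : ∀ (s : K) X Y, g (AdK I K s X) (AdK I K s Y) = g X Y
  J_Ad : ∀ (s : K) X, J (AdK I K s X) = AdK I K s (J X)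

variable {I K}

namespace AlmostHermitian

variable (h : AlmostHermitian I K)

/-- Compatibility of a connection with the Riemannian metric. -/
def IsCompatible (D : Connection I K) : Prop :=
  ∀ (U V W : vectorField I K) (x : G),
    dirDeriv I (fun y => h.g (V.1 y) (W.1 y)) x (U.1 x : GroupLieAlgebra I G) =
      h.g ((D.toFun U V).1 x) (W.1 x) + h.g (V.1 x) ((D.toFun U W).1 x)

/-- `J` acting pointwise on vector fields. -/
def Jfield (V : vectorField I K) : vectorField I K :=
  ⟨fun x => h.J (V.1 x), fun l => V.2.1 (l ∘ₗ h.J), fun x s => by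
    change h.J (V.1 (x * s)) = AdK I K s⁻¹ (h.J (V.1 x))
    rw [V.2.2, h.J_Ad]⟩

/-- A connection commutes with `J`. -/
def CommutesWithJ (D : Connection I K) : Prop :=
  ∀ V W : vectorField I K, D.toFun V (h.Jfield W) = h.Jfield (D.toFun V W)

/-- Standard module frames: finite families of vector fields such that
`V = ∑ⱼ W_j ⟨W_j, V⟩_A` for every vector field `V`. -/
def IsStandardFrame {n : ℕ} (W : Fin n → vectorField I K) : Prop :=
  ∀ (V : vectorField I K) (x : G), V.1 x = ∑ j, h.g ((W j).1 x) (V.1 x) • (W j).1 x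

/-- The action of `s ∈ K` on spinors by exterior-algebra automorphisms. -/
def AdSpin (s : K) : h.Spinor →ₐ[ℂ] h.Spinor :=
  ExteriorAlgebra.map (h.complexify (AdK I K s) fun X => (h.J_Ad s X).symm)

/-- The spinor fields on `G / K` for a character `χ` of `K`: smooth functions `ψ` from `G` to spinors
with `ψ (x s) = conj (χ s) Ad_s⁻¹ (ψ x)`. -/
def IsSpinorField (χ : K →ₜ* Circle) (ψ : G → h.Spinor) : Prop :=
  SmoothTo I ψ ∧
    ∀ (x : G) (s : K), ψ (x * s) = starRingEnd ℂ (χ s : ℂ) • h.AdSpin s⁻¹ (ψ x)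

open Classical in
/-- The extension to spinors, as a derivation, of the endomorphism `L_V (x)` of `𝔪`. (It is real-linear
and commutes with `J` whenever the connection commutes with `J`.) -/
def diffSpin (D : Connection I K) (V : vectorField I K) (x : G) : h.Spinor →ₗ[ℂ] h.Spinor :=
  if hL : ∃ l : h.MJ →ₗ[ℂ] h.MJ, ∀ w, l (h.toMJ w) = h.toMJ (D.diffEnd V x w) then
    h.extDer hL.choose
  else 0

/-- The connection on spinor fields: `∇ˢ_V ψ = ∇ᶜ_V ψ + Lˢ_V ψ`. -/
def spinConnection (D : Connection I K) (V : vectorField I K) (ψ : G → h.Spinor) (x : G) :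
    h.Spinor :=
  vecDeriv I ψ x (V.1 x : GroupLieAlgebra I G) + h.diffSpin D V x (ψ x)

theorem nondegenerate : h.g.Nondegenerate := by
  refine ⟨fun X hX => ?_, fun X hX => ?_⟩ <;>
  · by_contra hne
    exact (h.pos X hne).ne' (hX X)

/-- The Dirac operator `D ψ = κ (grad ψ)`. The value at `x` of `grad ψ` is the element
`∑ₚ eᵖ ⊗ (∇ˢ_{eₚ} ψ) (x)` of `𝔪 ⊗ 𝒮` which corresponds to the linear map `v ↦ (∇ˢ_v ψ) (x)` under the
identification of `𝔪` with its dual by `g`; here `eₚ` is a basis of `𝔪` and `eᵖ` is its dual basis for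
`g`. -/
def dirac (D : Connection I K) (ψ : G → h.Spinor) (x : G) : h.Spinor :=
  ∑ p, h.clifford (h.g.dualBasis h.nondegenerate (Module.finBasis ℝ (mm I K)) p)
    (h.spinConnection D (extendField I K x (Module.finBasis ℝ (mm I K) p)) ψ x)

/-- Formal self-adjointness of the Dirac operator on the spinor fields for `χ`, for the `L²` inner
product `∫ ⟨ψ, φ⟩` with respect to the measure `μ` on `G`. -/
def IsFormallySelfAdjoint [MeasurableSpace G] (μ : MeasureTheory.Measure G) (D : Connection I K)
    (χ : K →ₜ* Circle) : Prop :=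
  ∀ ψ φ : G → h.Spinor, h.IsSpinorField χ ψ → h.IsSpinorField χ φ →
    ∫ x, h.spinInner (h.dirac D ψ x) (φ x) ∂μ = ∫ x, h.spinInner (ψ x) (h.dirac D φ x) ∂μ

/-- The operator `S` on `𝔪` with `g (X, Y) = Kil (S X, Y)`, which exists uniquely because `Kil` is
definite when `G` is compact and semisimple. -/
def metricOp : mm I K →ₗ[ℝ] mm I K :=
  Classical.epsilon fun S : mm I K →ₗ[ℝ] mm I K =>
    ∀ X Y : mm I K, h.g X Y = Kil I G (S X : GroupLieAlgebra I G) (Y : GroupLieAlgebra I G)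

/-- `S^{1/2}`, the unique square root of `S` which is symmetric and positive for `Kil`. -/
def metricOpSqrt : mm I K →ₗ[ℝ] mm I K :=
  Classical.epsilon fun R : mm I K →ₗ[ℝ] mm I K =>
    (∀ X Y : mm I K, Kil I G (R X : GroupLieAlgebra I G) (Y : GroupLieAlgebra I G) =
      Kil I G (X : GroupLieAlgebra I G) (R Y : GroupLieAlgebra I G)) ∧
    (∀ X : mm I K, X ≠ 0 → 0 < Kil I G (R X : GroupLieAlgebra I G) (X : GroupLieAlgebra I G)) ∧
    R ∘ₗ R = h.metricOp

/-- `S^{-1/2}`, the inverse of `S^{1/2}` in the ring of endomorphisms of `𝔪`. -/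
def metricOpInvSqrt : mm I K →ₗ[ℝ] mm I K :=
  Ring.inverse (h.metricOpSqrt : Module.End ℝ (mm I K))

/-- Orthonormal bases of `𝔪` for `g`. -/
def IsOrthonormal (Y : Module.Basis (Fin (Module.finrank ℝ (mm I K))) ℝ (mm I K)) : Prop :=
  ∀ p q, h.g (Y p) (Y q) = if p = q then 1 else 0

/-- The sum `∑ₚ L_{X̂ₚ} (e) (S^{-1/2} Yₚ)` with `Xₚ = S^{1/2} Yₚ`. -/
def ikedaSum (D : Connection I K)
    (Y : Module.Basis (Fin (Module.finrank ℝ (mm I K))) ℝ (mm I K)) : mm I K :=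
  ∑ p, D.diffEnd (fundField I K (h.metricOpSqrt (Y p) : GroupLieAlgebra I G)) 1
    (h.metricOpInvSqrt (Y p))

end AlmostHermitian

end Group

end HomDirac

end

noncomputable section

namespace HomDirac

section LinearAlgebra

variable {V : Type*} [AddCommGroup V] [Module ℝ V]

/-- The inner product space core of a positive definite symmetric bilinear form. -/
abbrev coreOfBilin (B : LinearMap.BilinForm ℝ V) (hs : ∀ X Y, B X Y = B Y X)
    (hp : ∀ X, X ≠ 0 → 0 < B X X) : InnerProductSpace.Core ℝ V where
  inner X Y := B X Y
  conj_inner_symm X Y := by simpa using hs Y X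
  re_inner_nonneg X := by
    by_cases hX : X = 0
    · simp [hX]
    · simpa using (hp X hX).le
  add_left X Y Z := by simp
  smul_left X Y r := by simp
  definite X hX := by
    by_contra hne
    exact (hp X hne).ne' hX

/-- The families `a`, `b` resolve the identity with respect to the bilinear form `g`. -/
def IsResolution {ι : Type*} [Fintype ι] (g : LinearMap.BilinForm ℝ V) (a b : ι → V) : Prop :=
  ∀ v, v = ∑ j, g (b j) v • a j

theorem IsResolution.sum_eq {ι κ : Type*} [Fintype ι] [Fintype κ] {g : LinearMap.BilinForm ℝ V}
    (gp : ∀ X, X ≠ 0 → 0 < g X X) {a b : ι → V} {c d : κ → V}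
    (hab : IsResolution g a b) (hcd : IsResolution g c d) {N : Type*} [AddCommGroup N]
    [Module ℝ N] (β : V →ₗ[ℝ] V →ₗ[ℝ] N) : ∑ j, β (a j) (b j) = ∑ k, β (c k) (d k) := by
  have key : ∀ w, w = ∑ k, g w (c k) • d k := fun w => by
    rw [← sub_eq_zero]
    by_contra hne
    refine (gp _ hne).ne' ?_
    have hv : ∀ v, g (w - ∑ k, g w (c k) • d k) v = 0 := fun v => by
      rw [map_sub, LinearMap.sub_apply, sub_eq_zero]
      conv_lhs => rw [hcd v]
      simp [mul_comm]
    exact hv _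
  have h1 : ∀ k, β (c k) (d k) = ∑ j, g (b j) (c k) • β (a j) (d k) := fun k => by
    conv_lhs => rw [hab (c k)]
    simp
  have h2 : ∀ j, β (a j) (b j) = ∑ k, g (b j) (c k) • β (a j) (d k) := fun j => by
    conv_lhs => rw [key (b j)]
    simp
  simp only [h1, h2]
  exact Finset.sum_comm

theorem isResolution_orthonormal {ι : Type*} [Fintype ι] [DecidableEq ι]
    (g : LinearMap.BilinForm ℝ V) (Y : Module.Basis ι ℝ V)
    (hY : ∀ p q, g (Y p) (Y q) = if p = q then 1 else 0) : IsResolution g Y Y := fun v => by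
  obtain ⟨c, rfl⟩ : ∃ c : ι → ℝ, v = ∑ i, c i • Y i := ⟨Y.repr v, (Y.sum_repr v).symm⟩
  simp [hY]

theorem isResolution_dualBasis {ι : Type*} [Fintype ι] [DecidableEq ι]
    (g : LinearMap.BilinForm ℝ V) (hg : g.Nondegenerate)
    (Y : Module.Basis ι ℝ V) : IsResolution g Y (g.dualBasis hg Y) := fun v => by
  obtain ⟨c, rfl⟩ : ∃ c : ι → ℝ, v = ∑ i, c i • Y i := ⟨Y.repr v, (Y.sum_repr v).symm⟩
  simp [LinearMap.BilinForm.apply_dualBasis_left]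

variable [FiniteDimensional ℝ V]

theorem exists_orthonormal_basis (B : LinearMap.BilinForm ℝ V) (hs : ∀ X Y, B X Y = B Y X)
    (hp : ∀ X, X ≠ 0 → 0 < B X X) :
    ∃ b : Module.Basis (Fin (Module.finrank ℝ V)) ℝ V,
      ∀ i j, B (b i) (b j) = if i = j then 1 else 0 := by
  let c := coreOfBilin B hs hp
  let : NormedAddCommGroup V := c.toNormedAddCommGroup
  let : InnerProductSpace ℝ V := InnerProductSpace.ofCore c.toCore
  let b := stdOrthonormalBasis ℝ V
  refine ⟨b.toBasis, fun i j => ?_⟩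
  have := orthonormal_iff_ite.1 b.orthonormal i j
  rw [OrthonormalBasis.coe_toBasis]
  exact this

theorem exists_operator_of_bilin (B g : LinearMap.BilinForm ℝ V) (hs : ∀ X Y, B X Y = B Y X)
    (hp : ∀ X, X ≠ 0 → 0 < B X X) : ∃ S : V →ₗ[ℝ] V, ∀ X Y, g X Y = B (S X) Y := by
  obtain ⟨b, hb⟩ := exists_orthonormal_basis B hs hp
  refine ⟨∑ i, (g.flip (b i)).smulRight (b i), fun X Y => ?_⟩
  rw [← b.sum_repr Y]
  simp only [map_sum, map_smul, LinearMap.sum_apply, LinearMap.smulRight_apply,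
    LinearMap.smul_apply, hb, smul_eq_mul]
  simp

theorem exists_sqrt_of_bilin (B g : LinearMap.BilinForm ℝ V) (hs : ∀ X Y, B X Y = B Y X)
    (hp : ∀ X, X ≠ 0 → 0 < B X X) (gs : ∀ X Y, g X Y = g Y X) (gp : ∀ X, X ≠ 0 → 0 < g X X)
    (S : V →ₗ[ℝ] V) (hS : ∀ X Y, g X Y = B (S X) Y) :
    ∃ R : V →ₗ[ℝ] V, (∀ X Y, B (R X) Y = B X (R Y)) ∧ (∀ X, X ≠ 0 → 0 < B (R X) X) ∧
      R ∘ₗ R = S := by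
  let c := coreOfBilin B hs hp
  let : NormedAddCommGroup V := c.toNormedAddCommGroup
  let : InnerProductSpace ℝ V := InnerProductSpace.ofCore c.toCore
  have hsym : S.IsSymmetric := fun X Y => by
    change B (S X) Y = B X (S Y)
    rw [← hS, gs, hS, hs]
  let b := hsym.eigenvectorBasis rfl
  let l := hsym.eigenvalues rfl
  have hb : ∀ i j, B (b i) (b j) = if i = j then 1 else 0 := fun i j =>
    orthonormal_iff_ite.1 b.orthonormal i j
  have hSb : ∀ i, S (b i) = l i • b i := fun i => hsym.apply_eigenvectorBasis rfl i
  have hl : ∀ i, 0 < l i := fun i => by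
    have h1 := gp (b i) (b.orthonormal.ne_zero i)
    rw [hS, hSb] at h1
    simpa [hb] using h1
  clear_value l b
  generalize hb' : b.toBasis = b' at *
  have hbb : ∀ i, b i = b' i := fun i => by rw [← hb']; simp
  simp only [hbb] at hb hSb
  clear hbb hb'
  refine ⟨b'.constr ℝ fun i => √(l i) • b' i, fun X Y => ?_, fun X hX => ?_, ?_⟩
  · rw [← b'.sum_repr X, ← b'.sum_repr Y]
    generalize b'.repr X = c, b'.repr Y = d
    simp only [map_sum, map_smul, Module.Basis.constr_basis, LinearMap.sum_apply,
      LinearMap.smul_apply, hb, smul_eq_mul, mul_ite, mul_one, mul_zero, Finset.sum_ite_eq',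
      Finset.mem_univ, if_true]
    exact Finset.sum_congr rfl fun i _ => by ring
  · have : X = ∑ i, b'.repr X i • b' i := (b'.sum_repr X).symm
    rw [this]
    simp only [map_sum, map_smul, Module.Basis.constr_basis, LinearMap.sum_apply,
      LinearMap.smul_apply, hb, smul_eq_mul, mul_ite, mul_one, mul_zero]
    obtain ⟨i, hi⟩ : ∃ i, b'.repr X i ≠ 0 := by
      by_contra! hne
      exact hX (b'.repr.map_eq_zero_iff.1 (Finsupp.ext hne))
    refine Finset.sum_pos' (fun j _ => ?_) ⟨i, Finset.mem_univ _, ?_⟩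
    · simp only [Finset.sum_ite_eq', Finset.mem_univ, if_true]
      have := Real.sqrt_nonneg (l j)
      have := mul_self_nonneg (b'.repr X j)
      nlinarith
    · simp only [Finset.sum_ite_eq', Finset.mem_univ, if_true]
      have := Real.sqrt_pos.2 (hl i)
      have := mul_self_pos.2 hi
      nlinarith
  · refine b'.ext fun i => ?_
    simp [hSb, smul_smul, Real.mul_self_sqrt (hl i).le]

end LinearAlgebra

namespace HermSpace
variable {M : Type*} [AddCommGroup M] [Module ℝ M] (h : HermSpace M)

theorem annihilation_ι_mul (X : M) (Z : h.MJ) (ψ : h.Spinor) :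
    h.annihilation X (ExteriorAlgebra.ι ℂ Z * ψ) =
      h.herm X Z • ψ - ExteriorAlgebra.ι ℂ Z * h.annihilation X ψ :=
  CliffordAlgebra.contractLeft_ι_mul ..

theorem annihilation_one (X : M) : h.annihilation X 1 = 0 :=
  CliffordAlgebra.contractLeft_one (Q := (0 : QuadraticForm ℂ h.MJ)) _

/-- Spinors are generated from `1` by left multiplication with vectors. -/
theorem spinor_induction {C : h.Spinor → Prop} (hone : ∀ z : ℂ, C (z • 1))
    (hadd : ∀ a b, C a → C b → C (a + b)) (hmul : ∀ (X : M) a, C a →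
      C (ExteriorAlgebra.ι ℂ (h.toMJ X) * a)) (ψ : h.Spinor) : C ψ := by
  refine CliffordAlgebra.left_induction (Q := (0 : QuadraticForm ℂ h.MJ)) (P := C) ?_ ?_ ?_ ψ
  · intro r; rw [Algebra.algebraMap_eq_smul_one]; exact hone r
  · exact hadd
  · intro x m hx; exact hmul (h.toMJ.symm m) x hx

theorem spinInner_add_left (ψ ψ' φ : h.Spinor) :
    h.spinInner (ψ + ψ') φ = h.spinInner ψ φ + h.spinInner ψ' φ := map_add _ _ _

theorem spinInner_add_right (ψ φ φ' : h.Spinor) :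
    h.spinInner ψ (φ + φ') = h.spinInner ψ φ + h.spinInner ψ φ' := by
  simp [spinInner]

theorem spinInner_smul_left (c : ℂ) (ψ φ : h.Spinor) :
    h.spinInner (c • ψ) φ = starRingEnd ℂ c * h.spinInner ψ φ := by
  simp [spinInner]

theorem spinInner_smul_right (c : ℂ) (ψ φ : h.Spinor) :
    h.spinInner ψ (c • φ) = c * h.spinInner ψ φ := by
  simp [spinInner]

theorem spinInner_sub_left (ψ ψ' φ : h.Spinor) :
    h.spinInner (ψ - ψ') φ = h.spinInner ψ φ - h.spinInner ψ' φ := by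
  simp [spinInner]

theorem spinInner_sub_right (ψ φ φ' : h.Spinor) :
    h.spinInner ψ (φ - φ') = h.spinInner ψ φ - h.spinInner ψ φ' := by
  simp [spinInner]

theorem spinInner_creation_left (X : M) (ψ φ : h.Spinor) :
    h.spinInner (ExteriorAlgebra.ι ℂ (h.toMJ X) * ψ) φ =
      h.spinInner ψ (h.annihilation X φ) := by
  induction φ using h.spinor_induction generalizing ψ with
  | hone z =>
    rw [map_smul, annihilation_one, spinInner_smul_right, spinInner_one, smul_zero, map_mul]
    simp [ExteriorAlgebra.algebraMapInv, spinInner]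
  | hadd a b ha hb => rw [spinInner_add_right, ha, hb, map_add, spinInner_add_right]
  | hmul Y a ih =>
    rw [spinInner_ι_mul, annihilation_ι_mul, annihilation_ι_mul, spinInner_sub_left,
      spinInner_smul_left, spinInner_sub_right, spinInner_smul_right, ih, herm_symm,
      spinInner_ι_mul]

theorem clifford_apply (X : M) (ψ : h.Spinor) : h.clifford X ψ =
    Complex.I • (h.annihilation X ψ + ExteriorAlgebra.ι ℂ (h.toMJ X) * ψ) := rfl

theorem spinInner_clifford_left (X : M) (ψ φ : h.Spinor) :
    h.spinInner (h.clifford X ψ) φ = - h.spinInner ψ (h.clifford X φ) := by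
  rw [clifford_apply, clifford_apply, spinInner_smul_left, spinInner_smul_right,
    spinInner_add_left, spinInner_add_right, spinInner_creation_left, spinInner_ι_mul]
  simp; ring

/-- A complex-linear operator which is skew for `g` is skew for the Hermitian form. -/
theorem herm_comp_of_skew (l : h.MJ →ₗ[ℂ] h.MJ)
    (hl : ∀ X Y, h.g (h.toMJ.symm (l (h.toMJ X))) Y = - h.g X (h.toMJ.symm (l (h.toMJ Y))))
    (X : M) : h.herm X ∘ₗ l = - h.herm (h.toMJ.symm (l (h.toMJ X))) := by
  have hJ : ∀ X, h.J (h.toMJ.symm (l (h.toMJ X))) = h.toMJ.symm (l (h.toMJ (h.J X))) := fun X => by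
    have := l.map_smul Complex.I (h.toMJ X)
    simp [smul_def] at this
    rw [this]; simp
  refine LinearMap.ext fun Y => ?_
  obtain ⟨Y, rfl⟩ := h.toMJ.surjective Y
  simp [herm, hl, hJ]
  ring

section Derivation

variable [Module.Finite ℝ M]

theorem extDer_contractLeft (l : h.MJ →ₗ[ℂ] h.MJ) (d : Module.Dual ℂ h.MJ) (ψ : h.Spinor) :
    h.extDer l (CliffordAlgebra.contractLeft (Q := (0 : QuadraticForm ℂ h.MJ)) d ψ) =
      CliffordAlgebra.contractLeft (Q := (0 : QuadraticForm ℂ h.MJ)) d (h.extDer l ψ) -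
      CliffordAlgebra.contractLeft (Q := (0 : QuadraticForm ℂ h.MJ)) (d ∘ₗ l) ψ := by
  have key : ∀ (d : Module.Dual ℂ h.MJ) (X : h.MJ) (ψ : h.Spinor),
      CliffordAlgebra.contractLeft (Q := (0 : QuadraticForm ℂ h.MJ)) d
      (ExteriorAlgebra.ι ℂ X * ψ) = d X • ψ - ExteriorAlgebra.ι ℂ X *
        CliffordAlgebra.contractLeft (Q := (0 : QuadraticForm ℂ h.MJ)) d ψ := fun d X ψ =>
    CliffordAlgebra.contractLeft_ι_mul ..
  induction ψ using h.spinor_induction with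
  | hone z =>
    have h1 : ∀ d : Module.Dual ℂ h.MJ,
        CliffordAlgebra.contractLeft (Q := (0 : QuadraticForm ℂ h.MJ)) d (1 : h.Spinor) = 0 :=
      fun d => CliffordAlgebra.contractLeft_one ..
    simp only [map_smul, h1, extDer_one, smul_zero, map_zero, sub_zero]
  | hadd a b ha hb => simp only [map_add, ha, hb]; abel
  | hmul X a ih =>
    rw [key, map_sub, map_smul, extDer_ι_mul, extDer_ι_mul, map_add, key, key, key, ih,
      LinearMap.comp_apply, mul_sub]
    abel

theorem extDer_annihilation (l : h.MJ →ₗ[ℂ] h.MJ)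
    (hl : ∀ X Y, h.g (h.toMJ.symm (l (h.toMJ X))) Y = - h.g X (h.toMJ.symm (l (h.toMJ Y))))
    (X : M) (ψ : h.Spinor) : h.extDer l (h.annihilation X ψ) =
      h.annihilation X (h.extDer l ψ) + h.annihilation (h.toMJ.symm (l (h.toMJ X))) ψ := by
  unfold annihilation
  rw [extDer_contractLeft, herm_comp_of_skew h l hl]
  simp

theorem extDer_clifford (l : h.MJ →ₗ[ℂ] h.MJ)
    (hl : ∀ X Y, h.g (h.toMJ.symm (l (h.toMJ X))) Y = - h.g X (h.toMJ.symm (l (h.toMJ Y))))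
    (X : M) (ψ : h.Spinor) : h.extDer l (h.clifford X ψ) =
      h.clifford X (h.extDer l ψ) + h.clifford (h.toMJ.symm (l (h.toMJ X))) ψ := by
  rw [clifford_apply, clifford_apply, clifford_apply, map_smul, map_add, extDer_annihilation h l hl,
    extDer_ι_mul, AddEquiv.apply_symm_apply, ← smul_add]
  congr 1
  abel

theorem spinInner_extDer_left (l : h.MJ →ₗ[ℂ] h.MJ)
    (hl : ∀ X Y, h.g (h.toMJ.symm (l (h.toMJ X))) Y = - h.g X (h.toMJ.symm (l (h.toMJ Y))))
    (ψ φ : h.Spinor) : h.spinInner (h.extDer l ψ) φ = - h.spinInner ψ (h.extDer l φ) := by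
  induction φ using h.spinor_induction generalizing ψ with
  | hone z =>
    rw [map_smul, extDer_one, spinInner_smul_right, spinInner_one, smul_zero]
    have : ExteriorAlgebra.algebraMapInv (h.extDer l ψ) = (0 : ℂ) := by
      simp only [extDer, LinearMap.sum_apply, LinearMap.comp_apply, LinearMap.mulLeft_apply,
        map_sum, map_mul]
      simp [ExteriorAlgebra.algebraMapInv]
    rw [this]
    simp [spinInner]
  | hadd a b ha hb => rw [spinInner_add_right, ha, hb, map_add, spinInner_add_right]; ring
  | hmul Y a ih =>
    have h1 : h.annihilation Y (h.extDer l ψ) = h.extDer l (h.annihilation Y ψ) -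
        h.annihilation (h.toMJ.symm (l (h.toMJ Y))) ψ := by
      rw [extDer_annihilation h l hl]; abel
    have h2 := h.spinInner_ι_mul ψ a (h.toMJ.symm (l (h.toMJ Y)))
    rw [AddEquiv.apply_symm_apply] at h2
    rw [spinInner_ι_mul, h1, spinInner_sub_left, ih, extDer_ι_mul, spinInner_add_right,
      spinInner_ι_mul, h2]
    ring

end Derivation

end HermSpace

section HaarMeasure

open MeasureTheory Measure

instance isMulRightInvariant_of_compactSpace {G : Type*} [Group G] [TopologicalSpace G]
    [IsTopologicalGroup G] [CompactSpace G] [MeasurableSpace G] [BorelSpace G] (μ : Measure G)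
    [μ.IsHaarMeasure] : μ.IsMulRightInvariant := by
  refine ⟨fun g => ?_⟩
  have h1 := isMulInvariant_eq_smul_of_compactSpace (map (· * g) μ) μ
  have h2 : (map (· * g) μ) Set.univ = μ Set.univ := by
    rw [map_apply (measurable_mul_const g) MeasurableSet.univ, Set.preimage_univ]
  have h3 : μ Set.univ ≠ 0 := (isOpen_univ.measure_pos μ Set.univ_nonempty).ne'
  have h4 : μ Set.univ ≠ ⊤ := measure_ne_top _ _
  rw [h1] at h2 ⊢
  rw [Measure.smul_apply, ENNReal.smul_def, smul_eq_mul] at h2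
  have h5 := (ENNReal.mul_eq_right h3 h4).1 h2
  rw [ENNReal.coe_eq_one] at h5
  rw [h5, one_smul]

end HaarMeasure

section ParametricIntegral

open MeasureTheory

variable {E : Type*} [NormedAddCommGroup E] [NormedSpace ℝ E]
  {H : Type*} [TopologicalSpace H] {I : ModelWithCorners ℝ E H}
  {G : Type*} [TopologicalSpace G] [ChartedSpace H G] [IsManifold I ∞ G]
  {F : Type*} [NormedAddCommGroup F] [NormedSpace ℝ F]
  {f : F → G → ℝ} {U : Set F}

theorem contMDiffOn_fderiv_left (hU : IsOpen U)
    (hf : ContMDiffOn (𝓘(ℝ, F).prod I) 𝓘(ℝ, ℝ) ∞ (Function.uncurry f) (U ×ˢ Set.univ)) :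
    ContMDiffOn (𝓘(ℝ, F).prod I) 𝓘(ℝ, F →L[ℝ] ℝ) ∞
      (fun p : F × G => fderiv ℝ (fun u => f u p.2) p.1) (U ×ˢ Set.univ) := by
  rintro ⟨u, y⟩ ⟨hu, -⟩
  have h0 : ContMDiffAt (𝓘(ℝ, F).prod I) 𝓘(ℝ, ℝ) ∞ (Function.uncurry f) (u, y) :=
    hf.contMDiffAt ((hU.prod isOpen_univ).mem_nhds ⟨hu, trivial⟩)
  have h1 : ContMDiffAt ((𝓘(ℝ, F).prod I).prod 𝓘(ℝ, F)) 𝓘(ℝ, ℝ) ∞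
      (Function.uncurry fun (p : F × G) (u' : F) => f u' p.2) ((u, y), u) := by
    have h2 : ContMDiffAt ((𝓘(ℝ, F).prod I).prod 𝓘(ℝ, F)) (𝓘(ℝ, F).prod I) ∞
        (fun q : (F × G) × F => (q.2, q.1.2)) ((u, y), u) :=
      contMDiffAt_snd.prodMk (contMDiffAt_fst.snd)
    exact ContMDiffAt.comp ((u, y), u) (g := Function.uncurry f) h0 h2
  have h3 := ContMDiffAt.mfderiv (I := 𝓘(ℝ, F)) (I' := 𝓘(ℝ, ℝ)) (J := 𝓘(ℝ, F).prod I) (m := ∞)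
    (n := ∞) (fun (p : F × G) (u' : F) => f u' p.2) (fun p => p.1) h1 contMDiffAt_fst (by simp)
  simp only [mfderiv_eq_fderiv] at h3
  have h4 := inTangentCoordinates_model_space (I := 𝓘(ℝ, F)) (I' := 𝓘(ℝ, ℝ))
    (fun p : F × G => p.1) (fun p => f p.1 p.2)
    (fun p : F × G => fderiv ℝ (fun u => f u p.2) p.1) (u, y)
  exact (h4 ▸ h3).contMDiffWithinAt

variable {A : Type*} [TopologicalSpace A] [CompactSpace A] [MeasurableSpace A] [BorelSpace A]
  (ν : Measure A) [IsFiniteMeasure ν] {j : A → G} (hj : Continuous j) {c : A → ℝ}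
  (hc : Continuous c)

include hj hc in
theorem hasFDerivAt_parametric_integral [FiniteDimensional ℝ F] (hU : IsOpen U)
    (hf : ContMDiffOn (𝓘(ℝ, F).prod I) 𝓘(ℝ, ℝ) ∞ (Function.uncurry f) (U ×ˢ Set.univ))
    {u : F} (hu : u ∈ U) :
    Integrable (fun a => c a • fderiv ℝ (fun u => f u (j a)) u) ν ∧
    HasFDerivAt (fun u => ∫ a, c a * f u (j a) ∂ν)
      (∫ a, c a • fderiv ℝ (fun u => f u (j a)) u ∂ν) u := by
  have hp : ProperSpace F := FiniteDimensional.proper ℝ F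
  have hp2 : ProperSpace (F →L[ℝ] ℝ) := FiniteDimensional.proper ℝ _
  have hsc : SecondCountableTopology (F →L[ℝ] ℝ) := secondCountable_of_proper
  have hd : ContinuousOn (fun p : F × A => c p.2 • fderiv ℝ (fun u => f u (j p.2)) p.1)
      (U ×ˢ Set.univ) := by
    refine (hc.comp continuous_snd).continuousOn.smul ?_
    exact (contMDiffOn_fderiv_left hU hf).continuousOn.comp
      (f := fun p : F × A => (p.1, j p.2)) (by fun_prop) (fun p hp => ⟨hp.1, trivial⟩)
  have hd1 : ∀ u ∈ U, Continuous fun a => c a • fderiv ℝ (fun u => f u (j a)) u := fun u hu =>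
    hd.comp_continuous (f := fun a => (u, a)) (by fun_prop) (fun a => ⟨hu, trivial⟩)
  have hf0 : ∀ u ∈ U, Continuous fun a => c a * f u (j a) := fun u hu =>
    hc.mul (hf.continuousOn.comp_continuous (f := fun a => (u, j a)) (by fun_prop)
      (fun a => ⟨hu, trivial⟩))
  obtain ⟨ε, hε, hεU⟩ := Metric.nhds_basis_closedBall.mem_iff.1 (hU.mem_nhds hu)
  obtain ⟨B, hB⟩ := ((isCompact_closedBall u ε).prod
    (isCompact_univ (X := A))).exists_bound_of_continuousOn (hd.mono (Set.prod_mono_left hεU))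
  have hint : ∀ {F' : Type _} [NormedAddCommGroup F'] [SecondCountableTopology F'] {g : A → F'},
      Continuous g → Integrable g ν := fun {F'} _ _ g hg => by
    obtain ⟨B, hB⟩ := (isCompact_univ (X := A)).exists_bound_of_continuousOn hg.continuousOn
    exact Integrable.of_bound hg.aestronglyMeasurable B
      (Filter.Eventually.of_forall fun a => hB a trivial)
  refine ⟨hint (hd1 u hu), hasFDerivAt_integral_of_dominated_of_fderiv_le
    (F := fun u a => c a * f u (j a)) (F' := fun u a => c a • fderiv ℝ (fun u => f u (j a)) u)
    (bound := fun _ => B)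
    (Metric.closedBall_mem_nhds u hε) ?_ (hf0 u hu |>.integrable_of_hasCompactSupport
      (HasCompactSupport.of_compactSpace _)) (hd1 u hu).aestronglyMeasurable
    (Filter.Eventually.of_forall fun a x hx => hB (x, a) ⟨hx, trivial⟩) (integrable_const B) ?_⟩
  · filter_upwards [hU.mem_nhds hu] with x hx using (hf0 x hx).aestronglyMeasurable
  · refine Filter.Eventually.of_forall fun a x hx => ?_
    have h1 : ContMDiffAt 𝓘(ℝ, F) 𝓘(ℝ, ℝ) ∞ (fun u => f u (j a)) x := by
      have h0 : ContMDiffAt (𝓘(ℝ, F).prod I) 𝓘(ℝ, ℝ) ∞ (Function.uncurry f) (x, j a) :=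
        hf.contMDiffAt ((hU.prod isOpen_univ).mem_nhds ⟨hεU hx, trivial⟩)
      exact ContMDiffAt.comp x (f := fun u => (u, j a)) h0 (contMDiffAt_id.prodMk contMDiffAt_const)
    have h2 := (h1.contDiffAt.differentiableAt (by simp)).hasFDerivAt
    exact h2.const_smul (c a)

include hj hc in
theorem contDiffOn_parametric_integral [FiniteDimensional ℝ F] (hU : IsOpen U)
    (hf : ContMDiffOn (𝓘(ℝ, F).prod I) 𝓘(ℝ, ℝ) ∞ (Function.uncurry f) (U ×ˢ Set.univ)) :
    ContDiffOn ℝ ∞ (fun u => ∫ a, c a * f u (j a) ∂ν) U := by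
  refine contDiffOn_infty.2 fun n => ?_
  induction n generalizing f with
  | zero =>
    exact contDiffOn_zero.2 fun u hu =>
      (hasFDerivAt_parametric_integral ν hj hc hU hf hu).2.continuousAt.continuousWithinAt
  | succ n ih =>
    refine contDiffOn_succ_of_fderiv_apply (fun u hu =>
      (hasFDerivAt_parametric_integral ν hj hc hU hf
        hu).2.differentiableAt.differentiableWithinAt)
      (fun h => (WithTop.natCast_ne_top n h).elim) fun v => ?_
    refine (ih (f := fun u y => fderiv ℝ (fun u => f u y) u v) ?_).congr fun u hu => ?_
    · have := (contMDiffOn_fderiv_left hU hf).clm_apply (contMDiffOn_const (c := v))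
      exact this
    · have h1 := hasFDerivAt_parametric_integral ν hj hc hU hf hu
      rw [fderivWithin_of_isOpen hU hu, h1.2.fderiv,
        ContinuousLinearMap.integral_apply h1.1]
      rfl

end ParametricIntegral

section DirectionalDerivative

variable {E : Type*} [NormedAddCommGroup E] [NormedSpace ℝ E] [FiniteDimensional ℝ E]
  {H : Type*} [TopologicalSpace H] (I : ModelWithCorners ℝ E H)
  {G : Type*} [TopologicalSpace G] [ChartedSpace H G] [Group G] [LieGroup I ∞ G]

theorem mdifferentiableAt_mul_left (x z : G) : MDifferentiableAt I I (x * ·) z :=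
  (contMDiff_mul_left (I := I) (n := ∞) (a := x)).mdifferentiableAt (by simp)

variable {I}

theorem dirDeriv_eq_mfderiv_one {f : G → ℝ} (hf : ContMDiff I 𝓘(ℝ, ℝ) ∞ f) (x : G)
    (v : GroupLieAlgebra I G) :
    dirDeriv I f x v = (mfderiv I 𝓘(ℝ, ℝ) (fun z => f (x * z)) (1 : G) : E →L[ℝ] ℝ) v := by
  have h := mfderiv_comp (I := I) (I' := I) (I'' := 𝓘(ℝ, ℝ)) (1 : G) (g := f) (f := (x * ·))
    (hf.mdifferentiableAt (by simp)) (mdifferentiableAt_mul_left I x 1)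
  have h1 := DFunLike.congr_fun h v
  refine Eq.trans ?_ h1.symm
  have aux : ∀ (z : G) (_ : z = x) (w : E),
      (mfderiv I 𝓘(ℝ, ℝ) f x : E →L[ℝ] ℝ) w = (mfderiv I 𝓘(ℝ, ℝ) f z : E →L[ℝ] ℝ) w := by
    rintro z rfl w; rfl
  exact aux _ (mul_one x) _

theorem dirDeriv_mul_left {f : G → ℝ} (hf : ContMDiff I 𝓘(ℝ, ℝ) ∞ f) (a x : G)
    (v : GroupLieAlgebra I G) : dirDeriv I (fun y => f (a * y)) x v = dirDeriv I f (a * x) v := by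
  rw [dirDeriv_eq_mfderiv_one hf, dirDeriv_eq_mfderiv_one (f := fun y => f (a * y)) (hf.comp contMDiff_mul_left)]
  exact congrArg (fun F : G → ℝ => (mfderiv I 𝓘(ℝ, ℝ) F (1 : G) : E →L[ℝ] ℝ) v)
    (funext fun z => by rw [mul_assoc])

theorem dirDeriv_mul_right {f : G → ℝ} (hf : ContMDiff I 𝓘(ℝ, ℝ) ∞ f) (s x : G)
    (v : GroupLieAlgebra I G) :
    dirDeriv I (fun y => f (y * s)) x v = dirDeriv I f (x * s) (Ad I s⁻¹ v) := by
  rw [dirDeriv_eq_mfderiv_one hf, dirDeriv_eq_mfderiv_one (f := fun y => f (y * s)) (hf.comp contMDiff_mul_right)]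
  have h0 : ContMDiff I 𝓘(ℝ, ℝ) ∞ fun z => f (x * s * z) := hf.comp contMDiff_mul_left
  have h := mfderiv_comp (I := I) (I' := I) (I'' := 𝓘(ℝ, ℝ)) (1 : G) (g := fun z => f (x * s * z))
    (f := conj s⁻¹) (h0.mdifferentiableAt (by simp)) (mdiff_conj I s⁻¹ 1)
  have h1 : (fun z => f (x * s * z)) ∘ conj s⁻¹ = f ∘ fun z => x * z * s := by
    ext z; simp [conj, mul_assoc]
  rw [h1] at h
  refine (DFunLike.congr_fun h v).trans ?_
  have aux : ∀ (z : G) (_ : z = 1) (w : E),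
      (mfderiv I 𝓘(ℝ, ℝ) (fun z => f (x * s * z)) z : E →L[ℝ] ℝ) w =
        (mfderiv I 𝓘(ℝ, ℝ) (fun z => f (x * s * z)) (1 : G) : E →L[ℝ] ℝ) w := by
    rintro z rfl w; rfl
  exact aux _ (conj_one _) _

theorem dirDeriv_add_vec (f : G → ℝ) (x : G) (v w : GroupLieAlgebra I G) :
    dirDeriv I f x (v + w) = dirDeriv I f x v + dirDeriv I f x w := by
  unfold dirDeriv
  rw [mulInvariantVectorField_add]
  exact map_add _ _ _

theorem dirDeriv_smul_vec (f : G → ℝ) (x : G) (c : ℝ) (v : GroupLieAlgebra I G) :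
    dirDeriv I f x (c • v) = c * dirDeriv I f x v := by
  unfold dirDeriv
  rw [mulInvariantVectorField_smul]
  exact map_smul _ _ _

variable [I.Boundaryless]

theorem contMDiffOn_mul_chart {f : G → ℝ} (hf : ContMDiff I 𝓘(ℝ, ℝ) ∞ f) (x : G) :
    ContMDiffOn (𝓘(ℝ, E).prod I) 𝓘(ℝ, ℝ) ∞
      (Function.uncurry fun (u : E) (y : G) => f (y * (extChartAt I x).symm u))
      ((extChartAt I x).target ×ˢ Set.univ) := by
  have h1 : ContMDiffOn (𝓘(ℝ, E).prod I) I ∞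
      (fun p : E × G => p.2 * (extChartAt I x).symm p.1) ((extChartAt I x).target ×ˢ Set.univ) :=
    contMDiffOn_snd.mul ((contMDiffOn_extChartAt_symm x).comp contMDiffOn_fst fun p hp => hp.1)
  exact hf.comp_contMDiffOn h1

theorem contMDiffOn_chart_mul {f : G → ℝ} (hf : ContMDiff I 𝓘(ℝ, ℝ) ∞ f) (x : G) :
    ContMDiffOn (𝓘(ℝ, E).prod I) 𝓘(ℝ, ℝ) ∞
      (Function.uncurry fun (u : E) (y : G) => f ((extChartAt I x).symm u * y))
      ((extChartAt I x).target ×ˢ Set.univ) := by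
  have h1 : ContMDiffOn (𝓘(ℝ, E).prod I) I ∞
      (fun p : E × G => (extChartAt I x).symm p.1 * p.2) ((extChartAt I x).target ×ˢ Set.univ) :=
    ((contMDiffOn_extChartAt_symm x).comp contMDiffOn_fst fun p hp => hp.1).mul contMDiffOn_snd
  exact hf.comp_contMDiffOn h1

variable (I) in
/-- The coordinates of a Lie algebra element in the chart at the identity. -/
def chartVec (v : GroupLieAlgebra I G) : E :=
  (mfderiv I 𝓘(ℝ, E) (extChartAt I (1 : G)) (1 : G) : E →L[ℝ] E) v

theorem contDiffAt_mul_chart {f : G → ℝ} (hf : ContMDiff I 𝓘(ℝ, ℝ) ∞ f) (x : G) :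
    ContDiffAt ℝ ∞ (fun u : E => f (x * (extChartAt I (1 : G)).symm u)) (extChartAt I (1 : G) 1) := by
  have h := (contMDiffOn_mul_chart hf 1).contMDiffAt (x := (extChartAt I (1 : G) 1, x))
    (((isOpen_extChartAt_target (1 : G)).prod isOpen_univ).mem_nhds
      ⟨mem_extChartAt_target (1 : G), trivial⟩)
  exact (ContMDiffAt.comp (extChartAt I (1 : G) 1) (f := fun u : E => (u, x)) h
    (contMDiffAt_id.prodMk contMDiffAt_const)).contDiffAt

theorem dirDeriv_eq_fderiv {f : G → ℝ} (hf : ContMDiff I 𝓘(ℝ, ℝ) ∞ f) (x : G)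
    (v : GroupLieAlgebra I G) : dirDeriv I f x v =
      fderiv ℝ (fun u : E => f (x * (extChartAt I (1 : G)).symm u)) (extChartAt I (1 : G) 1)
        (chartVec I v) := by
  rw [dirDeriv_eq_mfderiv_one hf]
  set φ := extChartAt I (1 : G) with hφ
  have h0 := contDiffAt_mul_chart hf x
  have h := mfderiv_comp (I := I) (I' := 𝓘(ℝ, E)) (I'' := 𝓘(ℝ, ℝ)) (1 : G)
    (g := fun u : E => f (x * φ.symm u)) (f := φ)
    (h0.contMDiffAt.mdifferentiableAt (by simp))
    ((contMDiffAt_extChartAt (n := ∞)).mdifferentiableAt (by simp))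
  have h1 : (fun u : E => f (x * φ.symm u)) ∘ φ =ᶠ[nhds 1] fun z => f (x * z) := by
    filter_upwards [extChartAt_source_mem_nhds (I := I) (1 : G)] with z hz
    simp only [Function.comp_apply, φ.left_inv hz]
  rw [h1.mfderiv_eq, mfderiv_eq_fderiv] at h
  exact DFunLike.congr_fun h v

theorem contMDiff_dirDeriv {f : G → ℝ} (hf : ContMDiff I 𝓘(ℝ, ℝ) ∞ f) (v : GroupLieAlgebra I G) :
    ContMDiff I 𝓘(ℝ, ℝ) ∞ fun x => dirDeriv I f x v := by
  simp only [dirDeriv_eq_fderiv hf]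
  intro x
  have h := (contMDiffOn_fderiv_left (isOpen_extChartAt_target (1 : G))
    (contMDiffOn_mul_chart hf 1)).contMDiffAt (x := (extChartAt I (1 : G) 1, x))
    (((isOpen_extChartAt_target (1 : G)).prod isOpen_univ).mem_nhds
      ⟨mem_extChartAt_target (1 : G), trivial⟩)
  exact (ContMDiffAt.comp x (f := fun y : G => (extChartAt I (1 : G) 1, y)) h
    (contMDiffAt_const.prodMk contMDiffAt_id)).clm_apply contMDiffAt_const

theorem dirDeriv_add {f g : G → ℝ} (hf : ContMDiff I 𝓘(ℝ, ℝ) ∞ f) (hg : ContMDiff I 𝓘(ℝ, ℝ) ∞ g)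
    (x : G) (v : GroupLieAlgebra I G) :
    dirDeriv I (fun y => f y + g y) x v = dirDeriv I f x v + dirDeriv I g x v := by
  rw [dirDeriv_eq_fderiv hf, dirDeriv_eq_fderiv hg, 
    dirDeriv_eq_fderiv (f := fun y => f y + g y) (hf.add hg)]
  exact DFunLike.congr_fun (fderiv_add ((contDiffAt_mul_chart hf x).differentiableAt (by simp))
    ((contDiffAt_mul_chart hg x).differentiableAt (by simp))) _

theorem dirDeriv_mul {f g : G → ℝ} (hf : ContMDiff I 𝓘(ℝ, ℝ) ∞ f) (hg : ContMDiff I 𝓘(ℝ, ℝ) ∞ g)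
    (x : G) (v : GroupLieAlgebra I G) :
    dirDeriv I (fun y => f y * g y) x v = dirDeriv I f x v * g x + f x * dirDeriv I g x v := by
  rw [dirDeriv_eq_fderiv hf, dirDeriv_eq_fderiv hg, 
    dirDeriv_eq_fderiv (f := fun y => f y * g y) (hf.mul hg)]
  refine (DFunLike.congr_fun (fderiv_mul ((contDiffAt_mul_chart hf x).differentiableAt (by simp))
    ((contDiffAt_mul_chart hg x).differentiableAt (by simp))) _).trans ?_
  simp
  ring

theorem dirDeriv_const (c : ℝ) (x : G) (v : GroupLieAlgebra I G) :
    dirDeriv I (fun _ => c) x v = 0 := by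
  rw [dirDeriv_eq_fderiv contMDiff_const]
  simp

theorem dirDeriv_const_mul {f : G → ℝ} (hf : ContMDiff I 𝓘(ℝ, ℝ) ∞ f) (c : ℝ)
    (x : G) (v : GroupLieAlgebra I G) :
    dirDeriv I (fun y => c * f y) x v = c * dirDeriv I f x v := by
  rw [dirDeriv_mul contMDiff_const hf, dirDeriv_const, zero_mul, zero_add]

theorem dirDeriv_sum {ι : Type*} (s : Finset ι) {f : ι → G → ℝ}
    (hf : ∀ i, ContMDiff I 𝓘(ℝ, ℝ) ∞ (f i)) (x : G) (v : GroupLieAlgebra I G) :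
    dirDeriv I (fun y => ∑ i ∈ s, f i y) x v = ∑ i ∈ s, dirDeriv I (f i) x v := by
  classical
  induction s using Finset.induction_on with
  | empty => simpa using dirDeriv_const 0 x v
  | insert i s hi ih =>
    simp only [Finset.sum_insert hi]
    rw [dirDeriv_add (hf i) (contMDiff_finsetSum fun i _ => hf i), ih]

theorem integral_dirDeriv [CompactSpace G] [MeasurableSpace G] [BorelSpace G]
    (μ : MeasureTheory.Measure G) [μ.IsHaarMeasure] {f : G → ℝ} (hf : ContMDiff I 𝓘(ℝ, ℝ) ∞ f)
    (v : GroupLieAlgebra I G) : ∫ x, dirDeriv I f x v ∂μ = 0 := by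
  have : IsTopologicalGroup G := topologicalGroup_of_lieGroup I ∞
  have h := hasFDerivAt_parametric_integral μ (continuous_id (X := G)) (continuous_const (y := (1 : ℝ)))
    (isOpen_extChartAt_target (1 : G)) (contMDiffOn_mul_chart hf 1) (mem_extChartAt_target (1 : G))
  simp only [one_mul, one_smul, id_eq, MeasureTheory.integral_mul_right_eq_self f] at h
  have h1 := (hasFDerivAt_const (∫ x, f x ∂μ) (extChartAt I (1 : G) 1)).unique h.2
  simp only [dirDeriv_eq_fderiv hf]
  rw [← ContinuousLinearMap.integral_apply h.1, ← h1]
  rfl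

end DirectionalDerivative

section VectorDerivative

variable {E : Type*} [NormedAddCommGroup E] [NormedSpace ℝ E] [FiniteDimensional ℝ E]
  {H : Type*} [TopologicalSpace H] {I : ModelWithCorners ℝ E H} [I.Boundaryless]
  {G : Type*} [TopologicalSpace G] [ChartedSpace H G] [Group G] [LieGroup I ∞ G]
  {F : Type*} [AddCommGroup F] [Module ℝ F] [Module.Finite ℝ F]
  {F' : Type*} [AddCommGroup F'] [Module ℝ F'] [Module.Finite ℝ F']
  {F'' : Type*} [AddCommGroup F''] [Module ℝ F''] [Module.Finite ℝ F'']

theorem apply_eq_sum_coord (l : F →ₗ[ℝ] F') (a : F) :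
    l a = ∑ i, (Module.finBasis ℝ F).coord i a • l (Module.finBasis ℝ F i) := by
  conv_lhs => rw [← (Module.finBasis ℝ F).sum_repr a, map_sum]
  simp only [map_smul, Module.Basis.coord_apply]

theorem SmoothTo.comp_linear {f : G → F} (hf : SmoothTo I f) (l : F →ₗ[ℝ] F') :
    SmoothTo I fun x => l (f x) := fun k => hf (k ∘ₗ l)

theorem SmoothTo.bilin {f : G → F} {g : G → F'} (hf : SmoothTo I f) (hg : SmoothTo I g)
    (β : F →ₗ[ℝ] F' →ₗ[ℝ] F'') : SmoothTo I fun x => β (f x) (g x) := by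
  intro l
  have h1 : (fun x => l (β (f x) (g x))) = fun x => ∑ i, (Module.finBasis ℝ F).coord i (f x) *
      (l ∘ₗ β (Module.finBasis ℝ F i)) (g x) := by
    ext x
    exact apply_eq_sum_coord (l ∘ₗ β.flip (g x)) (f x)
  rw [h1]
  exact contMDiff_finsetSum fun i _ => (hf _).mul (hg _)

theorem SmoothTo.add {f g : G → F} (hf : SmoothTo I f) (hg : SmoothTo I g) :
    SmoothTo I fun x => f x + g x := fun l => by
  simp only [map_add]
  exact (hf l).add (hg l)

theorem SmoothTo.sum {ι : Type*} (s : Finset ι) {f : ι → G → F} (hf : ∀ i, SmoothTo I (f i)) :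
    SmoothTo I fun x => ∑ i ∈ s, f i x := fun l => by
  simp only [map_sum]
  exact contMDiff_finsetSum fun i _ => hf i l

theorem SmoothTo.of_contMDiff {f : G → ℝ} (hf : ContMDiff I 𝓘(ℝ, ℝ) ∞ f) : SmoothTo I f :=
  fun l => l.toContinuousLinearMap.contMDiff.comp hf

theorem SmoothTo.contMDiff {f : G → ℝ} (hf : SmoothTo I f) : ContMDiff I 𝓘(ℝ, ℝ) ∞ f :=
  hf LinearMap.id

theorem apply_vecDeriv {f : G → F} (hf : SmoothTo I f) (l : F →ₗ[ℝ] ℝ) (x : G)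
    (v : GroupLieAlgebra I G) : l (vecDeriv I f x v) = dirDeriv I (fun y => l (f y)) x v := by
  have h1 : (fun x => l (f x)) = fun x => ∑ i, l (Module.finBasis ℝ F i) *
      (Module.finBasis ℝ F).coord i (f x) := by
    ext x
    simpa only [smul_eq_mul, mul_comm] using apply_eq_sum_coord l (f x)
  rw [h1, dirDeriv_sum (f := fun i y => l (Module.finBasis ℝ F i) *
    (Module.finBasis ℝ F).coord i (f y)) _ fun i => contMDiff_const.mul (hf _)]
  simp only [dirDeriv_const_mul (hf _), vecDeriv, map_sum, map_smul, smul_eq_mul]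
  exact Finset.sum_congr rfl fun i _ => mul_comm _ _

theorem eq_of_forall_linear {a b : F} (h : ∀ l : F →ₗ[ℝ] ℝ, l a = l b) : a = b :=
  (Module.finBasis ℝ F).ext_elem fun i => h ((Module.finBasis ℝ F).coord i)

theorem map_vecDeriv {f : G → F} (hf : SmoothTo I f) (l : F →ₗ[ℝ] F') (x : G)
    (v : GroupLieAlgebra I G) : l (vecDeriv I f x v) = vecDeriv I (fun y => l (f y)) x v :=
  eq_of_forall_linear fun k => by
    rw [apply_vecDeriv (hf.comp_linear l), ← LinearMap.comp_apply, apply_vecDeriv hf]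
    rfl

theorem dirDeriv_bilin {f : G → F} {g : G → F'} (hf : SmoothTo I f) (hg : SmoothTo I g)
    (β : F →ₗ[ℝ] F' →ₗ[ℝ] ℝ) (x : G) (v : GroupLieAlgebra I G) :
    dirDeriv I (fun y => β (f y) (g y)) x v =
      β (vecDeriv I f x v) (g x) + β (f x) (vecDeriv I g x v) := by
  have h1 : (fun x => β (f x) (g x)) = fun x => ∑ i, (Module.finBasis ℝ F).coord i (f x) *
      β (Module.finBasis ℝ F i) (g x) := by
    ext x
    exact apply_eq_sum_coord (β.flip (g x)) (f x)
  rw [h1, dirDeriv_sum (f := fun i y => (Module.finBasis ℝ F).coord i (f y) *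
    β (Module.finBasis ℝ F i) (g y)) _ fun i => (hf _).mul (hg _)]
  simp only [dirDeriv_mul (hf _) (hg _), Finset.sum_add_distrib]
  congr 1
  · simp [vecDeriv]
  · simp only [← apply_vecDeriv hg]
    exact (apply_eq_sum_coord (β.flip (vecDeriv I g x v)) (f x)).symm

theorem vecDeriv_bilin {f : G → F} {g : G → F'} (hf : SmoothTo I f) (hg : SmoothTo I g)
    (β : F →ₗ[ℝ] F' →ₗ[ℝ] F'') (x : G) (v : GroupLieAlgebra I G) :
    vecDeriv I (fun y => β (f y) (g y)) x v =
      β (vecDeriv I f x v) (g x) + β (f x) (vecDeriv I g x v) :=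
  eq_of_forall_linear fun k => by
    rw [apply_vecDeriv (hf.bilin hg β), map_add]
    exact dirDeriv_bilin hf hg (β.compr₂ k) x v

theorem vecDeriv_add {f g : G → F} (hf : SmoothTo I f) (hg : SmoothTo I g)
    (x : G) (v : GroupLieAlgebra I G) :
    vecDeriv I (fun y => f y + g y) x v = vecDeriv I f x v + vecDeriv I g x v :=
  eq_of_forall_linear fun k => by
    simp only [apply_vecDeriv (hf.add hg), map_add, dirDeriv_add (hf k) (hg k),
      apply_vecDeriv hf, apply_vecDeriv hg]

theorem SmoothTo.vecDeriv {f : G → F} (hf : SmoothTo I f) (v : GroupLieAlgebra I G) :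
    SmoothTo I fun x => vecDeriv I f x v := fun l => by
  simp only [apply_vecDeriv hf]
  exact contMDiff_dirDeriv (hf l) v

variable (I) in
/-- The derivative of `f` at `x` as a linear map on the Lie algebra. -/
def vecDerivLin (f : G → F) (x : G) : GroupLieAlgebra I G →ₗ[ℝ] F where
  toFun := vecDeriv I f x
  map_add' v w := by simp [vecDeriv, dirDeriv_add_vec, add_smul, Finset.sum_add_distrib]
  map_smul' c v := by simp [vecDeriv, dirDeriv_smul_vec, mul_smul, Finset.smul_sum]

theorem vecDeriv_mul_left {f : G → F} (hf : SmoothTo I f) (a x : G) (v : GroupLieAlgebra I G) :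
    vecDeriv I (fun y => f (a * y)) x v = vecDeriv I f (a * x) v :=
  Finset.sum_congr rfl fun i _ => by rw [← dirDeriv_mul_left (hf _)]

theorem vecDeriv_mul_right {f : G → F} (hf : SmoothTo I f) (s x : G) (v : GroupLieAlgebra I G) :
    vecDeriv I (fun y => f (y * s)) x v = vecDeriv I f (x * s) (Ad I s⁻¹ v) :=
  Finset.sum_congr rfl fun i _ => by rw [← dirDeriv_mul_right (hf _)]

end VectorDerivative

section AdjointDerivative

open Filter Topology

/-- For a local product `m` on a vector space with unit `u₀`, the Lie bracket of left-invariant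
vector fields is the derivative of the adjoint action `a`. -/
theorem lieBracket_of_local_product {E : Type*} [NormedAddCommGroup E] [NormedSpace ℝ E]
    {m : E × E → E} {u₀ : E} (hm : ContDiffAt ℝ 2 m (u₀, u₀))
    (hl : ∀ᶠ v in 𝓝 u₀, m (u₀, v) = v) (hr : ∀ᶠ u in 𝓝 u₀, m (u, u₀) = u) {x w : E} {a : E → E}
    (ha : DifferentiableAt ℝ a u₀)
    (h : ∀ᶠ u in 𝓝 u₀, fderiv ℝ m (u, u₀) (0, w) = fderiv ℝ m (u₀, u) (a u, 0)) {V W : E → E}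
    (hV : ∀ᶠ u in 𝓝 u₀, V u = fderiv ℝ m (u, u₀) (0, x))
    (hW : ∀ᶠ u in 𝓝 u₀, W u = fderiv ℝ m (u, u₀) (0, w)) :
    VectorField.lieBracket ℝ V W u₀ = fderiv ℝ a u₀ x := by
  have hd : HasFDerivAt m (fderiv ℝ m (u₀, u₀)) (u₀, u₀) :=
    (hm.differentiableAt (by norm_num)).hasFDerivAt
  have hd2 : HasFDerivAt (fderiv ℝ m) (fderiv ℝ (fderiv ℝ m) (u₀, u₀)) (u₀, u₀) :=
    ((hm.fderiv_right (m := 1) (by norm_num)).differentiableAt (by norm_num)).hasFDerivAt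
  set M := fderiv ℝ (fderiv ℝ m) (u₀, u₀) with hM
  have hsym : ∀ p q, M p q = M q p := fun p q =>
    (hm.isSymmSndFDerivAt (by rw [minSmoothness_of_isRCLikeNormedField])) p q
  have hleft : HasFDerivAt (fun u : E => (u, u₀)) (ContinuousLinearMap.inl ℝ E E) u₀ :=
    hasFDerivAt_prodMk_left u₀ u₀
  have hright : HasFDerivAt (fun u : E => (u₀, u)) (ContinuousLinearMap.inr ℝ E E) u₀ :=
    hasFDerivAt_prodMk_right u₀ u₀
  have e1 : ∀ y, fderiv ℝ m (u₀, u₀) (0, y) = y := fun y => by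
    have h1 := (hd.comp u₀ hright).congr_of_eventuallyEq (hl.mono fun _ h => h.symm)
    exact DFunLike.congr_fun (h1.unique (hasFDerivAt_id u₀)) y
  have e2 : ∀ y, fderiv ℝ m (u₀, u₀) (y, 0) = y := fun y => by
    have h1 := (hd.comp (f := fun u : E => (u, u₀)) u₀ hleft).congr_of_eventuallyEq (hr.mono fun _ h => h.symm)
    exact DFunLike.congr_fun (h1.unique (hasFDerivAt_id u₀)) y
  have f1 : ∀ y, HasFDerivAt (fun u => fderiv ℝ m (u, u₀) (0, y))
      ((M ∘L ContinuousLinearMap.inl ℝ E E).flip (0, y)) u₀ := fun y => by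
    simpa using (hd2.comp (f := fun u : E => (u, u₀)) u₀ hleft).clm_apply (hasFDerivAt_const ((0 : E), y) u₀)
  have f2 : HasFDerivAt (fun u => fderiv ℝ m (u₀, u) (a u, 0))
      ((fderiv ℝ m (u₀, u₀)) ∘L (ContinuousLinearMap.inl ℝ E E ∘L fderiv ℝ a u₀) +
        (M ∘L ContinuousLinearMap.inr ℝ E E).flip (a u₀, 0)) u₀ := by
    have h1 : HasFDerivAt (fun u => (a u, (0 : E)))
        (ContinuousLinearMap.inl ℝ E E ∘L fderiv ℝ a u₀) u₀ :=
      (ContinuousLinearMap.inl ℝ E E).hasFDerivAt.comp u₀ ha.hasFDerivAt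
    exact (hd2.comp u₀ hright).clm_apply h1
  have ha0 : a u₀ = w := by
    have := h.self_of_nhds
    rw [e1, e2] at this
    exact this.symm
  have h3 := DFunLike.congr_fun ((f1 w).unique (f2.congr_of_eventuallyEq h)) x
  simp only [ContinuousLinearMap.flip_apply, ContinuousLinearMap.comp_apply,
    add_apply, ContinuousLinearMap.inl_apply, ContinuousLinearMap.inr_apply,
    e2, ha0] at h3
  have hV' := (f1 x).congr_of_eventuallyEq hV
  have hW' := (f1 w).congr_of_eventuallyEq hW
  rw [VectorField.lieBracket_eq]
  simp only [hV'.fderiv, hW'.fderiv, hV.self_of_nhds, hW.self_of_nhds, e1,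
    ContinuousLinearMap.flip_apply, ContinuousLinearMap.comp_apply, ContinuousLinearMap.inl_apply]
  rw [h3, hsym (w, 0) (0, x)]
  abel

variable {E : Type*} [NormedAddCommGroup E] [NormedSpace ℝ E] [FiniteDimensional ℝ E]
  {H : Type*} [TopologicalSpace H] (I : ModelWithCorners ℝ E H) [I.Boundaryless]
  {G : Type*} [TopologicalSpace G] [ChartedSpace H G] [Group G] [LieGroup I ∞ G]

variable (G) in
/-- The product of `G` in the chart at the identity. -/
def chartMul (p : E × E) : E :=
  extChartAt I (1 : G) ((extChartAt I (1 : G)).symm p.1 * (extChartAt I (1 : G)).symm p.2)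

theorem contDiffAt_chartMul_of_mem {p : E × E} (h1 : p.1 ∈ (extChartAt I (1 : G)).target)
    (h2 : p.2 ∈ (extChartAt I (1 : G)).target)
    (h3 : (extChartAt I (1 : G)).symm p.1 * (extChartAt I (1 : G)).symm p.2 ∈
      (extChartAt I (1 : G)).source) : ContDiffAt ℝ ∞ (chartMul I G) p := by
  have s : ∀ q ∈ (extChartAt I (1 : G)).target,
      ContMDiffAt 𝓘(ℝ, E) I ∞ (extChartAt I (1 : G)).symm q := fun q hq =>
    (contMDiffOn_extChartAt_symm (1 : G)).contMDiffAt (extChartAt_target_mem_nhds' hq)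
  have hm : ContMDiffAt 𝓘(ℝ, E × E) I ∞ (fun p : E × E =>
      (extChartAt I (1 : G)).symm p.1 * (extChartAt I (1 : G)).symm p.2) p :=
    ((s _ h1).comp p contDiffAt_fst.contMDiffAt).mul ((s _ h2).comp p contDiffAt_snd.contMDiffAt)
  refine ContMDiffAt.contDiffAt ?_
  rw [extChartAt_source] at h3
  exact (contMDiffAt_extChartAt' h3).comp p hm

theorem fderiv_chartMul_right {u : E} (hu : u ∈ (extChartAt I (1 : G)).target)
    (w : GroupLieAlgebra I G) :
    fderiv ℝ (chartMul I G) (u, extChartAt I (1 : G) 1) (0, chartVec I w) =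
    (mfderiv I 𝓘(ℝ, E) (fun z : G => extChartAt I (1 : G) ((extChartAt I (1 : G)).symm u * z))
      (1 : G) : E →L[ℝ] E) w := by
  set φ := extChartAt I (1 : G) with hφ
  have hc : ContDiffAt ℝ ∞ (chartMul I G) (u, φ 1) :=
    contDiffAt_chartMul_of_mem I hu (mem_extChartAt_target (1 : G)) (by
      simpa [φ] using φ.map_target hu)
  have hd : HasFDerivAt (fun v => chartMul I G (u, v))
      (fderiv ℝ (chartMul I G) (u, φ 1) ∘L ContinuousLinearMap.inr ℝ E E) (φ 1) :=
    (hc.differentiableAt (by simp)).hasFDerivAt.comp (φ 1) (hasFDerivAt_prodMk_right u (φ 1))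
  have h := mfderiv_comp (I := I) (I' := 𝓘(ℝ, E)) (I'' := 𝓘(ℝ, E)) (1 : G)
    (g := fun v => chartMul I G (u, v)) (f := φ) hd.differentiableAt.mdifferentiableAt
    ((contMDiffAt_extChartAt (n := ∞)).mdifferentiableAt (by simp))
  have h1 : (fun v => chartMul I G (u, v)) ∘ φ =ᶠ[𝓝 1] fun z => φ (φ.symm u * z) := by
    filter_upwards [extChartAt_source_mem_nhds (I := I) (1 : G)] with z hz
    simp only [Function.comp_apply, chartMul, ← hφ, φ.left_inv hz]
  rw [h1.mfderiv_eq, mfderiv_eq_fderiv, hd.fderiv] at h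
  exact (DFunLike.congr_fun h w).symm

theorem fderiv_chartMul_left {u : E} (hu : u ∈ (extChartAt I (1 : G)).target)
    (w : GroupLieAlgebra I G) :
    fderiv ℝ (chartMul I G) (extChartAt I (1 : G) 1, u) (chartVec I w, 0) =
    (mfderiv I 𝓘(ℝ, E) (fun z : G => extChartAt I (1 : G) (z * (extChartAt I (1 : G)).symm u))
      (1 : G) : E →L[ℝ] E) w := by
  set φ := extChartAt I (1 : G) with hφ
  have hc : ContDiffAt ℝ ∞ (chartMul I G) (φ 1, u) :=
    contDiffAt_chartMul_of_mem I (mem_extChartAt_target (1 : G)) hu (by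
      simpa [φ] using φ.map_target hu)
  have hd : HasFDerivAt (fun v => chartMul I G (v, u))
      (fderiv ℝ (chartMul I G) (φ 1, u) ∘L ContinuousLinearMap.inl ℝ E E) (φ 1) :=
    (hc.differentiableAt (by simp)).hasFDerivAt.comp (f := fun v : E => (v, u)) (φ 1)
      (hasFDerivAt_prodMk_left (φ 1) u)
  have h := mfderiv_comp (I := I) (I' := 𝓘(ℝ, E)) (I'' := 𝓘(ℝ, E)) (1 : G)
    (g := fun v => chartMul I G (v, u)) (f := φ) hd.differentiableAt.mdifferentiableAt
    ((contMDiffAt_extChartAt (n := ∞)).mdifferentiableAt (by simp))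
  have h1 : (fun v => chartMul I G (v, u)) ∘ φ =ᶠ[𝓝 1] fun z => φ (z * φ.symm u) := by
    filter_upwards [extChartAt_source_mem_nhds (I := I) (1 : G)] with z hz
    simp only [Function.comp_apply, chartMul, ← hφ, φ.left_inv hz]
  rw [h1.mfderiv_eq, mfderiv_eq_fderiv, hd.fderiv] at h
  exact (DFunLike.congr_fun h w).symm

theorem mdifferentiableAt_chart {g : G} (hg : g ∈ (extChartAt I (1 : G)).source) :
    MDifferentiableAt I 𝓘(ℝ, E) (extChartAt I (1 : G)) g := by
  rw [extChartAt_source] at hg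
  exact (contMDiffAt_extChartAt' (n := ∞) hg).mdifferentiableAt (by simp)

theorem mfderiv_chart_mulInvariantVectorField {u : E} (hu : u ∈ (extChartAt I (1 : G)).target)
    (w : GroupLieAlgebra I G) :
    (mfderiv I 𝓘(ℝ, E) (extChartAt I (1 : G)) ((extChartAt I (1 : G)).symm u) : E →L[ℝ] E)
      (mulInvariantVectorField w ((extChartAt I (1 : G)).symm u)) =
    fderiv ℝ (chartMul I G) (u, extChartAt I (1 : G) 1) (0, chartVec I w) := by
  rw [fderiv_chartMul_right I hu]
  have hg := (extChartAt I (1 : G)).map_target hu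
  generalize (extChartAt I (1 : G)).symm u = g at hg ⊢
  have h := mfderiv_comp (I := I) (I' := I) (I'' := 𝓘(ℝ, E)) (1 : G)
    (g := extChartAt I (1 : G)) (f := (g * ·)) (mdifferentiableAt_chart I (by simpa using hg))
    (mdifferentiableAt_mul_left I g 1)
  refine Eq.trans ?_ (DFunLike.congr_fun h w).symm
  have aux : ∀ (z : G) (_ : z = g) (w : E),
      (mfderiv I 𝓘(ℝ, E) (extChartAt I (1 : G)) g : E →L[ℝ] E) w =
        (mfderiv I 𝓘(ℝ, E) (extChartAt I (1 : G)) z : E →L[ℝ] E) w := by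
    rintro z rfl w; rfl
  exact aux _ (mul_one g) _

theorem fderiv_chartMul_Ad {u : E} (hu : u ∈ (extChartAt I (1 : G)).target)
    (w : GroupLieAlgebra I G) :
    fderiv ℝ (chartMul I G) (u, extChartAt I (1 : G) 1) (0, chartVec I w) =
    fderiv ℝ (chartMul I G) (extChartAt I (1 : G) 1, u)
      (chartVec I (Ad I ((extChartAt I (1 : G)).symm u) w), 0) := by
  rw [fderiv_chartMul_right I hu, fderiv_chartMul_left I hu]
  have hg := (extChartAt I (1 : G)).map_target hu
  generalize (extChartAt I (1 : G)).symm u = g at hg ⊢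
  have h0 : ∀ z : G, z = 1 → MDifferentiableAt I 𝓘(ℝ, E)
      (fun z : G => extChartAt I (1 : G) (z * g)) z := by
    rintro z rfl
    exact MDifferentiableAt.comp (g := extChartAt I (1 : G)) (f := (· * g)) 1
      (mdifferentiableAt_chart I (by simpa using hg))
      ((contMDiff_mul_right (I := I) (n := ∞) (a := g)).mdifferentiableAt (by simp))
  have h := mfderiv_comp (I := I) (I' := I) (I'' := 𝓘(ℝ, E)) (1 : G)
    (g := fun z : G => extChartAt I (1 : G) (z * g)) (f := conj g) (h0 _ (conj_one g))
    (mdiff_conj I g 1)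
  have h1 : (fun z : G => extChartAt I (1 : G) (z * g)) ∘ conj g =
      fun z => extChartAt I (1 : G) (g * z) := by
    ext z; simp [conj]
  rw [h1] at h
  refine (DFunLike.congr_fun h w).trans ?_
  have aux : ∀ (z : G) (_ : z = 1) (w : E),
      (mfderiv I 𝓘(ℝ, E) (fun z : G => extChartAt I (1 : G) (z * g)) z : E →L[ℝ] E) w =
        (mfderiv I 𝓘(ℝ, E) (fun z : G => extChartAt I (1 : G) (z * g)) (1 : G) : E →L[ℝ] E) w := by
    rintro z rfl w; rfl
  exact aux _ (conj_one g) _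

theorem mpullbackWithin_mulInvariantVectorField {u : E}
    (hu : u ∈ (extChartAt I (1 : G)).target) (w : GroupLieAlgebra I G) :
    VectorField.mpullbackWithin 𝓘(ℝ, E) I (extChartAt I (1 : G)).symm
      (mulInvariantVectorField w : ∀ g : G, TangentSpace I g) (Set.range I) u =
    fderiv ℝ (chartMul I G) (u, extChartAt I (1 : G) 1) (0, chartVec I w) := by
  rw [← mfderiv_chart_mulInvariantVectorField I hu w]
  have h := mfderivWithin_extChartAt_symm_comp_mfderiv_extChartAt (I := I) hu
  exact (isInvertible_mfderivWithin_extChartAt_symm hu).inverse_apply_eq.2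
    (DFunLike.congr_fun h (mulInvariantVectorField w ((extChartAt I (1 : G)).symm u))).symm

theorem chartVec_injective : Function.Injective (chartVec I (G := G)) := by
  have := isInvertible_mfderiv_extChartAt (I := I) (mem_extChartAt_source (I := I) (1 : G))
  exact this.injective

theorem chartVec_lie (X W : GroupLieAlgebra I G) : chartVec I ⁅X, W⁆ =
    fderiv ℝ (fun u : E => chartVec I (Ad I ((extChartAt I (1 : G)).symm u) W))
      (extChartAt I (1 : G) 1) (chartVec I X) := by
  have hinv := isInvertible_mfderiv_extChartAt (I := I) (mem_extChartAt_source (I := I) (1 : G))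
  set φ := extChartAt I (1 : G) with hφ
  have ht : ∀ᶠ u in 𝓝 (φ 1), u ∈ φ.target := extChartAt_target_mem_nhds (1 : G)
  have h0 : chartVec I ⁅X, W⁆ = VectorField.lieBracketWithin ℝ
      (VectorField.mpullbackWithin 𝓘(ℝ, E) I φ.symm
        (mulInvariantVectorField X : ∀ g : G, TangentSpace I g) (Set.range I))
      (VectorField.mpullbackWithin 𝓘(ℝ, E) I φ.symm
        (mulInvariantVectorField W : ∀ g : G, TangentSpace I g) (Set.range I))
      (φ.symm ⁻¹' Set.univ ∩ Set.range I) (φ 1) := (hinv.inverse_apply_eq.1 rfl).symm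
  have h1 : ∀ V W : E → E, VectorField.lieBracketWithin ℝ V W
      (φ.symm ⁻¹' Set.univ ∩ Set.range I) = VectorField.lieBracket ℝ V W := fun V W => by
    rw [Set.preimage_univ, I.range_eq_univ, Set.univ_inter, VectorField.lieBracketWithin_univ]
  refine h0.trans ((congrFun (h1 _ _) _).trans ?_)
  have ha : DifferentiableAt ℝ (fun u : E => chartVec I (Ad I (φ.symm u) W)) (φ 1) := by
    have h1 : ContMDiffAt 𝓘(ℝ, E) I ∞ φ.symm (φ 1) :=
      (contMDiffOn_extChartAt_symm (1 : G)).contMDiffAt ht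
    have h2 : ContMDiffAt 𝓘(ℝ, E) 𝓘(ℝ, E) ∞ (fun u : E => AdL I (φ.symm u) W) (φ 1) :=
      (contMDiff_Ad I W).contMDiffAt.comp (φ 1) h1
    exact (show E →L[ℝ] E from
      mfderiv I 𝓘(ℝ, E) (extChartAt I (1 : G)) (1 : G)).differentiableAt.comp (φ 1) (h2.contDiffAt.differentiableAt (by simp))
  have hs : φ.symm (φ 1) = 1 := φ.left_inv (mem_extChartAt_source (1 : G))
  refine lieBracket_of_local_product (m := chartMul I G)
    ((contDiffAt_chartMul_of_mem I (mem_extChartAt_target (1 : G)) (mem_extChartAt_target (1 : G))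
      (by
        change φ.symm (φ 1) * φ.symm (φ 1) ∈ φ.source
        rw [hs, mul_one]
        exact mem_extChartAt_source (1 : G))).of_le ENat.LEInfty.out) ?_ ?_ ha
    (ht.mono fun u hu => fderiv_chartMul_Ad I hu W)
    (ht.mono fun u hu => mpullbackWithin_mulInvariantVectorField I hu X)
    (ht.mono fun u hu => mpullbackWithin_mulInvariantVectorField I hu W)
  · filter_upwards [ht] with u hu
    simp only [chartMul, ← hφ, hs, one_mul, φ.right_inv hu]
  · filter_upwards [ht] with u hu
    simp only [chartMul, ← hφ, hs, mul_one, φ.right_inv hu]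

theorem smoothTo_Ad (W : GroupLieAlgebra I G) : SmoothTo I fun y : G => Ad I y W := fun l =>
  (LinearMap.toContinuousLinearMap (show E →ₗ[ℝ] ℝ from l)).contMDiff.comp (contMDiff_Ad I W)

/-- The derivative of the adjoint action of `G` is the adjoint action of the Lie algebra. -/
theorem vecDeriv_Ad (X W : GroupLieAlgebra I G) :
    vecDeriv I (fun y : G => Ad I y W) 1 X = ⁅X, W⁆ := by
  apply chartVec_injective I
  let τ : GroupLieAlgebra I G →ₗ[ℝ] E :=
    (show E →L[ℝ] E from mfderiv I 𝓘(ℝ, E) (extChartAt I (1 : G)) (1 : G)).toLinearMap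
  refine eq_of_forall_linear fun k => ?_
  have h1 := apply_vecDeriv (smoothTo_Ad I W) (k ∘ₗ τ) 1 X
  refine h1.trans ?_
  rw [chartVec_lie, dirDeriv_eq_fderiv ((smoothTo_Ad I W) (k ∘ₗ τ))]
  simp only [one_mul]
  have h2 : ContMDiffAt 𝓘(ℝ, E) 𝓘(ℝ, E) ∞
      (fun u : E => AdL I ((extChartAt I (1 : G)).symm u) W) (extChartAt I (1 : G) 1) :=
    (contMDiff_Ad I W).contMDiffAt.comp _
      ((contMDiffOn_extChartAt_symm (1 : G)).contMDiffAt (extChartAt_target_mem_nhds (1 : G)))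
  have h3 : DifferentiableAt ℝ
      (fun u : E => chartVec I (Ad I ((extChartAt I (1 : G)).symm u) W)) (extChartAt I (1 : G) 1) :=
    (show E →L[ℝ] E from
      mfderiv I 𝓘(ℝ, E) (extChartAt I (1 : G)) (1 : G)).differentiableAt.comp _
      (h2.contDiffAt.differentiableAt (by simp))
  have h4 := (k.toContinuousLinearMap.hasFDerivAt.comp _ h3.hasFDerivAt).fderiv
  exact DFunLike.congr_fun h4 _

end AdjointDerivative

section KillingForm

open MeasureTheory

theorem trace_comp_self_neg_of_skew {V : Type*} [AddCommGroup V] [Module ℝ V]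
    [FiniteDimensional ℝ V] (B : LinearMap.BilinForm ℝ V) (hs : ∀ X Y, B X Y = B Y X)
    (hp : ∀ X, X ≠ 0 → 0 < B X X) (T : V →ₗ[ℝ] V) (hT : ∀ X Y, B (T X) Y = - B X (T Y))
    (h0 : T ≠ 0) : LinearMap.trace ℝ V (T ∘ₗ T) < 0 := by
  obtain ⟨b, hb⟩ := exists_orthonormal_basis B hs hp
  have hrepr : ∀ (v : V) i, b.repr v i = B (b i) v := fun v i => by
    obtain ⟨c, rfl⟩ : ∃ c : _ → ℝ, v = ∑ i, c i • b i := ⟨b.repr v, (b.sum_repr v).symm⟩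
    rw [b.repr_sum_self]
    simp [hb]
  have h1 : LinearMap.trace ℝ V (T ∘ₗ T) = ∑ i, - B (T (b i)) (T (b i)) := by
    rw [LinearMap.trace_eq_matrix_trace ℝ b, Matrix.trace]
    refine Finset.sum_congr rfl fun i _ => ?_
    rw [Matrix.diag_apply, LinearMap.toMatrix_apply, hrepr, LinearMap.comp_apply, hs, hT]
  rw [h1, Finset.sum_neg_distrib, neg_lt_zero]
  obtain ⟨i, hi⟩ : ∃ i, T (b i) ≠ 0 := by
    by_contra! hne
    exact h0 (b.ext fun i => by simp [hne i])
  refine Finset.sum_pos' (fun j _ => ?_) ⟨i, Finset.mem_univ _, hp _ hi⟩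
  by_cases hj : T (b j) = 0
  · simp [hj]
  · exact (hp _ hj).le

variable {E : Type*} [NormedAddCommGroup E] [NormedSpace ℝ E] [FiniteDimensional ℝ E]
  {H : Type*} [TopologicalSpace H] (I : ModelWithCorners ℝ E H) [I.Boundaryless]
  {G : Type*} [TopologicalSpace G] [ChartedSpace H G] [Group G] [LieGroup I ∞ G]

variable (G) in
/-- An auxiliary inner product on the Lie algebra. -/
def coordForm : LinearMap.BilinForm ℝ (GroupLieAlgebra I G) :=
  ∑ i, ((Module.finBasis ℝ (GroupLieAlgebra I G)).coord i).smulRight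
    ((Module.finBasis ℝ (GroupLieAlgebra I G)).coord i)

theorem coordForm_apply (v w : GroupLieAlgebra I G) : coordForm I G v w =
    ∑ i, (Module.finBasis ℝ (GroupLieAlgebra I G)).coord i v *
      (Module.finBasis ℝ (GroupLieAlgebra I G)).coord i w := by
  simp [coordForm]

theorem coordForm_pos {v : GroupLieAlgebra I G} (hv : v ≠ 0) : 0 < coordForm I G v v := by
  rw [coordForm_apply]
  obtain ⟨i, hi⟩ : ∃ i, (Module.finBasis ℝ (GroupLieAlgebra I G)).coord i v ≠ 0 := by
    by_contra! hne
    exact hv ((Module.finBasis ℝ (GroupLieAlgebra I G)).forall_coord_eq_zero_iff.1 hne)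
  exact Finset.sum_pos' (fun j _ => mul_self_nonneg _) ⟨i, Finset.mem_univ _, mul_self_pos.2 hi⟩

variable [CompactSpace G] [MeasurableSpace G] [BorelSpace G] (μ : Measure G) [μ.IsHaarMeasure]

theorem continuous_coordForm_Ad (v w : GroupLieAlgebra I G) :
    Continuous fun y : G => coordForm I G (Ad I y v) (Ad I y w) :=
  ((smoothTo_Ad I v).bilin (smoothTo_Ad I w) (coordForm I G)).contMDiff.continuous

theorem integrable_coordForm_Ad (v w : GroupLieAlgebra I G) :
    Integrable (fun y : G => coordForm I G (Ad I y v) (Ad I y w)) μ :=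
  (continuous_coordForm_Ad I v w).integrable_of_hasCompactSupport
    (HasCompactSupport.of_compactSpace _)

/-- An `Ad`-invariant inner product on the Lie algebra of a compact group. -/
def invForm : LinearMap.BilinForm ℝ (GroupLieAlgebra I G) :=
  LinearMap.mk₂ ℝ (fun v w => ∫ y, coordForm I G (Ad I y v) (Ad I y w) ∂μ)
    (fun v v' w => by
      simp only [map_add, LinearMap.add_apply]
      exact integral_add (integrable_coordForm_Ad I μ v w) (integrable_coordForm_Ad I μ v' w))
    (fun c v w => by
      simp only [map_smul, LinearMap.smul_apply, smul_eq_mul]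
      exact integral_const_mul c _)
    (fun v w w' => by
      simp only [map_add]
      exact integral_add (integrable_coordForm_Ad I μ v w) (integrable_coordForm_Ad I μ v w'))
    (fun c v w => by
      simp only [map_smul, smul_eq_mul]
      exact integral_const_mul c _)

theorem invForm_apply (v w : GroupLieAlgebra I G) :
    invForm I μ v w = ∫ y, coordForm I G (Ad I y v) (Ad I y w) ∂μ := rfl

theorem invForm_symm (v w : GroupLieAlgebra I G) : invForm I μ v w = invForm I μ w v := by
  simp only [invForm_apply, coordForm_apply, mul_comm]

theorem Ad_injective (y : G) : Function.Injective (Ad I y) :=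
  Function.LeftInverse.injective (g := Ad I y⁻¹) (Ad_inv_apply I y)

theorem invForm_pos (v : GroupLieAlgebra I G) (hv : v ≠ 0) : 0 < invForm I μ v v := by
  rw [invForm_apply]
  have h : ∀ y : G, 0 < coordForm I G (Ad I y v) (Ad I y v) := fun y =>
    coordForm_pos I fun h0 => hv (Ad_injective I y (h0.trans (map_zero _).symm))
  exact (continuous_coordForm_Ad I v v).integral_pos_of_hasCompactSupport_nonneg_nonzero
    (HasCompactSupport.of_compactSpace _) (fun y => (h y).le) (x := 1) (h 1).ne'

theorem invForm_Ad (x : G) (v w : GroupLieAlgebra I G) :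
    invForm I μ (Ad I x v) (Ad I x w) = invForm I μ v w := by
  have : IsTopologicalGroup G := topologicalGroup_of_lieGroup I ∞
  simp only [invForm_apply, ← Ad_mul]
  exact integral_mul_right_eq_self (fun y => coordForm I G (Ad I y v) (Ad I y w)) x

theorem invForm_lie (X v w : GroupLieAlgebra I G) :
    invForm I μ ⁅X, v⁆ w = - invForm I μ v ⁅X, w⁆ := by
  have h := dirDeriv_bilin (smoothTo_Ad I v) (smoothTo_Ad I w) (invForm I μ) 1 X
  simp only [invForm_Ad, dirDeriv_const, vecDeriv_Ad, Ad_one, LinearMap.id_apply] at h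
  linarith

variable [LieAlgebra.IsSemisimple ℝ (GroupLieAlgebra I G)]

include μ in
theorem Kil_pos_of_isHaarMeasure (X : GroupLieAlgebra I G) (hX : X ≠ 0) : 0 < Kil I G X X := by
  have h0 : LieAlgebra.ad ℝ (GroupLieAlgebra I G) X ≠ 0 := fun h => hX (by
    have h1 : X ∈ LieAlgebra.center ℝ (GroupLieAlgebra I G) := by
      refine (LieModule.mem_maxTrivSubmodule (R := ℝ) _ _ _).2 fun Y => ?_
      have h2 : ⁅X, Y⁆ = 0 := DFunLike.congr_fun h Y
      rw [← lie_skew, h2, neg_zero]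
    rwa [LieAlgebra.center_eq_bot, LieSubmodule.mem_bot] at h1)
  have := trace_comp_self_neg_of_skew (invForm I μ) (invForm_symm I μ) (invForm_pos I μ)
    (LieAlgebra.ad ℝ (GroupLieAlgebra I G) X) (fun v w => invForm_lie I μ X v w) h0
  change 0 < - killingForm ℝ (GroupLieAlgebra I G) X X
  rw [killingForm_apply_apply]
  linarith

theorem Kil_symm (v w : GroupLieAlgebra I G) : Kil I G v w = Kil I G w v := by
  change - killingForm ℝ (GroupLieAlgebra I G) v w = - killingForm ℝ (GroupLieAlgebra I G) w v
  rw [killingForm_apply_apply, killingForm_apply_apply, LinearMap.trace_comp_comm']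

/-- For a compact semisimple group, `Kil` is positive definite. -/
theorem Kil_pos (X : GroupLieAlgebra I G) (hX : X ≠ 0) : 0 < Kil I G X X := by
  have : IsTopologicalGroup G := topologicalGroup_of_lieGroup I ∞
  exact Kil_pos_of_isHaarMeasure I MeasureTheory.Measure.haar X hX

variable (K : Subgroup G)

theorem isCompl_mm_lieK : IsCompl (mm I K) (lieK I K) := by
  have h := (LinearMap.BilinForm.isCompl_orthogonal_iff_disjoint (B := Kil I G)
    (W := lieK I K) fun v w h => by rw [Kil_symm, h]).2 ?_
  · exact h.symm
  · rw [Submodule.disjoint_def]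
    intro X hX hX'
    by_contra hne
    exact (Kil_pos I X hne).ne' (hX' X hX)

theorem projm_coe (w : mm I K) : projm I K (w : GroupLieAlgebra I G) = w := by
  unfold projm
  rw [dif_pos (isCompl_mm_lieK I K)]
  exact Submodule.projectionOnto_apply_left _ w

theorem Kil_projm (X : GroupLieAlgebra I G) (w : mm I K) :
    Kil I G (projm I K X : GroupLieAlgebra I G) w = Kil I G X w := by
  have h := isCompl_mm_lieK I K
  have h1 : X - projm I K X ∈ lieK I K := by
    unfold projm
    rw [dif_pos h]
    exact Submodule.sub_projection_mem h X
  have h2 := w.2 _ h1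
  rw [map_sub, LinearMap.sub_apply] at h2
  linarith

end KillingForm

section Connections

variable {E : Type*} [NormedAddCommGroup E] [NormedSpace ℝ E] [FiniteDimensional ℝ E]
  {H : Type*} [TopologicalSpace H] (I : ModelWithCorners ℝ E H) [I.Boundaryless]
  {G : Type*} [TopologicalSpace G] [ChartedSpace H G] [Group G] [LieGroup I ∞ G]

section Canonical

variable {I} {K : Subgroup G}

theorem canonical_add_left (U V W : vectorField I K) (x : G) :
    canonical I K (U + V) W x = canonical I K U W x + canonical I K V W x :=
  (vecDerivLin I W.1 x).map_add (U.1 x : GroupLieAlgebra I G) (V.1 x : GroupLieAlgebra I G)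

theorem canonical_mulField_left (f : smoothFun I K) (V W : vectorField I K) (x : G) :
    canonical I K (mulField I K f V) W x = f.1 x • canonical I K V W x :=
  (vecDerivLin I W.1 x).map_smul (f.1 x) (V.1 x : GroupLieAlgebra I G)

theorem canonical_add_right (U V W : vectorField I K) (x : G) :
    canonical I K U (V + W) x = canonical I K U V x + canonical I K U W x :=
  vecDeriv_add V.2.1 W.2.1 x _

theorem canonical_mulField_right (f : smoothFun I K) (V W : vectorField I K) (x : G) :
    canonical I K V (mulField I K f W) x =
      f.1 x • canonical I K V W x + dirDeriv I f.1 x (V.1 x : GroupLieAlgebra I G) • W.1 x := by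
  have h := vecDeriv_bilin (SmoothTo.of_contMDiff f.2.1) W.2.1 (LinearMap.lsmul ℝ (mm I K)) x
    (V.1 x : GroupLieAlgebra I G)
  have h1 : vecDeriv I f.1 x (V.1 x : GroupLieAlgebra I G) =
      dirDeriv I f.1 x (V.1 x : GroupLieAlgebra I G) :=
    apply_vecDeriv (SmoothTo.of_contMDiff f.2.1) LinearMap.id x _
  rw [h1, add_comm] at h
  exact h

theorem canonical_translate (a : G) (V W : vectorField I K) (x : G) :
    canonical I K (translate I K a V) (translate I K a W) x = canonical I K V W (a⁻¹ * x) :=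
  vecDeriv_mul_left W.2.1 a⁻¹ x _

theorem canonical_mul_right (V W : vectorField I K) (x : G) (s : K) :
    canonical I K V W (x * s) = AdK I K s⁻¹ (canonical I K V W x) := by
  unfold canonical
  rw [map_vecDeriv W.2.1]
  simp only [← W.2.2]
  rw [vecDeriv_mul_right W.2.1, V.2.2]
  rfl

end Canonical

namespace Connection

variable {I} {K : Subgroup G} (D : Connection I K)

theorem diff_add_left (U V W : vectorField I K) (x : G) :
    D.diff (U + V) W x = D.diff U W x + D.diff V W x := by
  unfold diff
  rw [D.add_left, canonical_add_left]
  change (D.toFun U W).1 x + (D.toFun V W).1 x - _ = _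
  abel

theorem diff_mulField_left (f : smoothFun I K) (V W : vectorField I K) (x : G) :
    D.diff (mulField I K f V) W x = f.1 x • D.diff V W x := by
  unfold diff
  rw [D.smul_left, canonical_mulField_left, smul_sub]
  rfl

theorem diff_add_right (U V W : vectorField I K) (x : G) :
    D.diff U (V + W) x = D.diff U V x + D.diff U W x := by
  unfold diff
  rw [D.add_right, canonical_add_right]
  change (D.toFun U V).1 x + (D.toFun U W).1 x - _ = _
  abel

theorem diff_mulField_right (f : smoothFun I K) (V W : vectorField I K) (x : G) :
    D.diff V (mulField I K f W) x = f.1 x • D.diff V W x := by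
  unfold diff
  rw [D.leibniz, canonical_mulField_right, smul_sub]
  abel

theorem diff_sum_left {ι : Type*} (s : Finset ι) (V : ι → vectorField I K) (W : vectorField I K)
    (x : G) : D.diff (∑ i ∈ s, V i) W x = ∑ i ∈ s, D.diff (V i) W x :=
  map_sum (AddMonoidHom.mk' (fun U => D.diff U W x) fun U V => D.diff_add_left U V W x) V s

theorem diff_sum_right {ι : Type*} (s : Finset ι) (V : vectorField I K) (W : ι → vectorField I K)
    (x : G) : D.diff V (∑ i ∈ s, W i) x = ∑ i ∈ s, D.diff V (W i) x :=
  map_sum (AddMonoidHom.mk' (fun U => D.diff V U x) fun U W => D.diff_add_right V U W x) W s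

theorem diff_translate (hD : D.IsInvariant) (a : G) (V W : vectorField I K) (x : G) :
    D.diff (translate I K a V) (translate I K a W) x = D.diff V W (a⁻¹ * x) := by
  unfold diff
  rw [hD, canonical_translate]
  rfl

theorem diff_mul_right (V W : vectorField I K) (x : G) (s : K) :
    D.diff V W (x * s) = AdK I K s⁻¹ (D.diff V W x) := by
  unfold diff
  rw [canonical_mul_right, (D.toFun V W).2.2, map_sub]

end Connection

variable [CompactSpace G] [MeasurableSpace G] [BorelSpace G]
  [LieAlgebra.IsSemisimple ℝ (GroupLieAlgebra I G)] (K : Subgroup G)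

theorem fundField_apply (X : GroupLieAlgebra I G) (x : G) :
    (fundField I K X).1 x = -projm I K (Ad I x⁻¹ X) := rfl

theorem extendField_apply_self (x : G) (w : mm I K) : (extendField I K x w).1 x = w := by
  unfold extendField
  rw [fundField_apply, map_neg, map_neg, neg_neg, Ad_inv_apply, projm_coe]

/-- A basis of the Lie algebra which is orthonormal for `Kil`. -/
def kilBasis : Module.Basis (Fin (Module.finrank ℝ (GroupLieAlgebra I G))) ℝ
    (GroupLieAlgebra I G) :=
  (exists_orthonormal_basis (Kil I G) (Kil_symm I) (Kil_pos I)).choose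

theorem isResolution_kilBasis : IsResolution (Kil I G) (kilBasis I (G := G)) (kilBasis I) :=
  isResolution_orthonormal _ _
    (exists_orthonormal_basis (Kil I G) (Kil_symm I) (Kil_pos I)).choose_spec

theorem sum_Kil_fundField (x : G) (v : mm I K) :
    v = ∑ j, Kil I G ((fundField I K (kilBasis I j)).1 x : GroupLieAlgebra I G) v •
      (fundField I K (kilBasis I j)).1 x := by
  have h1 : ∀ j, Kil I G ((fundField I K (kilBasis I j)).1 x : GroupLieAlgebra I G) v =
      - Kil I G (kilBasis I j) (Ad I x v) := fun j => by
    rw [fundField_apply, Submodule.coe_neg, map_neg, LinearMap.neg_apply, Kil_projm, Kil_Ad_left]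
  simp only [h1]
  simp only [fundField_apply, smul_neg, neg_smul, neg_neg]
  simp only [← map_smul]
  rw [← map_sum, ← map_sum, ← isResolution_kilBasis I (Ad I x v), Ad_inv_apply, projm_coe]

/-- The coefficient `Kil (X̂_j, V)` of a vector field, as a function on `G / K`. -/
def kilCoeff (V : vectorField I K) (j : Fin (Module.finrank ℝ (GroupLieAlgebra I G))) :
    smoothFun I K :=
  ⟨fun x => Kil I G ((fundField I K (kilBasis I j)).1 x : GroupLieAlgebra I G)
    (V.1 x : GroupLieAlgebra I G),
  ((fundField I K (kilBasis I j)).2.1.bilin V.2.1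
    ((Kil I G).compl₁₂ (mm I K).subtype (mm I K).subtype)).contMDiff, fun x s => by
    beta_reduce
    rw [V.2.2, (fundField I K (kilBasis I j)).2.2]
    exact Kil_Ad I _ _ _⟩

theorem eq_sum_mulField (V : vectorField I K) :
    V = ∑ j, mulField I K (kilCoeff I K V j) (fundField I K (kilBasis I j)) := by
  refine Subtype.ext (funext fun x => ?_)
  refine (sum_Kil_fundField I K x (V.1 x)).trans ?_
  rw [AddSubmonoidClass.coe_finsetSum, Finset.sum_apply]
  rfl

namespace Connection

variable {I K} (D : Connection I K)

theorem diff_eq_sum_left (V W : vectorField I K) (x : G) : D.diff V W x =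
    ∑ j, Kil I G ((fundField I K (kilBasis I j)).1 x : GroupLieAlgebra I G)
      (V.1 x : GroupLieAlgebra I G) • D.diff (fundField I K (kilBasis I j)) W x := by
  conv_lhs => rw [eq_sum_mulField I K V]
  rw [diff_sum_left]
  exact Finset.sum_congr rfl fun j _ => diff_mulField_left ..

theorem diff_eq_sum_right (V W : vectorField I K) (x : G) : D.diff V W x =
    ∑ j, Kil I G ((fundField I K (kilBasis I j)).1 x : GroupLieAlgebra I G)
      (W.1 x : GroupLieAlgebra I G) • D.diff V (fundField I K (kilBasis I j)) x := by
  conv_lhs => rw [eq_sum_mulField I K W]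
  rw [diff_sum_right]
  exact Finset.sum_congr rfl fun j _ => diff_mulField_right ..

theorem diff_congr {V V' W W' : vectorField I K} {x : G} (hV : V.1 x = V'.1 x)
    (hW : W.1 x = W'.1 x) : D.diff V W x = D.diff V' W' x := by
  rw [diff_eq_sum_left, hV, ← diff_eq_sum_left, diff_eq_sum_right, hW, ← diff_eq_sum_right]

/-- The bilinear map on `𝔪` which represents `L = ∇ - ∇ᶜ` at the identity. -/
def diffBilin : mm I K →ₗ[ℝ] mm I K →ₗ[ℝ] mm I K :=
  LinearMap.mk₂ ℝ (fun v w => D.diff (extendField I K 1 v) (extendField I K 1 w) 1)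
    (fun v v' w => by
      simp only [D.diff_eq_sum_left (extendField I K 1 _), extendField_apply_self,
        Submodule.coe_add, map_add, add_smul, Finset.sum_add_distrib])
    (fun c v w => by
      simp only [D.diff_eq_sum_left (extendField I K 1 _), extendField_apply_self,
        Submodule.coe_smul, map_smul, smul_assoc, Finset.smul_sum])
    (fun v w w' => by
      simp only [D.diff_eq_sum_right _ (extendField I K 1 _), extendField_apply_self,
        Submodule.coe_add, map_add, add_smul, Finset.sum_add_distrib])
    (fun c v w => by
      simp only [D.diff_eq_sum_right _ (extendField I K 1 _), extendField_apply_self,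
        Submodule.coe_smul, map_smul, smul_assoc, Finset.smul_sum])

theorem diffBilin_apply (v w : mm I K) :
    D.diffBilin v w = D.diff (extendField I K 1 v) (extendField I K 1 w) 1 := rfl

variable (hD : D.IsInvariant)
include hD

theorem diff_eq_diffBilin (V W : vectorField I K) (x : G) :
    D.diff V W x = D.diffBilin (V.1 x) (W.1 x) := by
  have h := D.diff_translate hD x⁻¹ V W 1
  rw [inv_inv, mul_one] at h
  rw [← h, diffBilin_apply]
  refine D.diff_congr ?_ ?_ <;>
  · rw [extendField_apply_self]
    simp [translate]

theorem diffEnd_eq_diffBilin (V : vectorField I K) (x : G) (w : mm I K) :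
    D.diffEnd V x w = D.diffBilin (V.1 x) w := by
  rw [diffEnd, diff_eq_diffBilin D hD, extendField_apply_self]

theorem diffBilin_AdK (s : K) (v w : mm I K) :
    D.diffBilin (AdK I K s v) (AdK I K s w) = AdK I K s (D.diffBilin v w) := by
  have h1 := D.diff_mul_right (extendField I K 1 v) (extendField I K 1 w) 1 s⁻¹
  rw [diff_eq_diffBilin D hD, (extendField I K 1 v).2.2, (extendField I K 1 w).2.2,
    extendField_apply_self, extendField_apply_self, inv_inv] at h1
  exact h1

theorem diffBilin_skew {h : AlmostHermitian I K} (hg : h.IsCompatible D) (u v w : mm I K) :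
    h.g (D.diffBilin u v) w = - h.g v (D.diffBilin u w) := by
  have h1 := hg (extendField I K 1 u) (extendField I K 1 v) (extendField I K 1 w) 1
  have h2 := dirDeriv_bilin (extendField I K 1 v).2.1 (extendField I K 1 w).2.1 h.g 1
    ((extendField I K 1 u).1 1 : GroupLieAlgebra I G)
  rw [h2] at h1
  simp only [diffBilin_apply, diff, map_sub, LinearMap.sub_apply, extendField_apply_self] at h1 ⊢
  simp only [canonical, extendField_apply_self]
  linarith

theorem diffBilin_J {h : AlmostHermitian I K} (hJ : h.CommutesWithJ D) (u v : mm I K) :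
    D.diffBilin u (h.J v) = h.J (D.diffBilin u v) := by
  have h1 : D.diffBilin u (h.J v) = D.diff (extendField I K 1 u) (h.Jfield (extendField I K 1 v)) 1 := by
    rw [diff_eq_diffBilin D hD, extendField_apply_self]
    change _ = D.diffBilin u (h.J ((extendField I K 1 v).1 1))
    rw [extendField_apply_self]
  rw [h1, diffBilin_apply, diff, diff, hJ, map_sub]
  congr 1
  exact (map_vecDeriv (extendField I K 1 v).2.1 h.J 1 _).symm

end Connection

end Connections

theorem sqrt_unique {V : Type*} [AddCommGroup V] [Module ℝ V] [FiniteDimensional ℝ V]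
    (B : LinearMap.BilinForm ℝ V) (hs : ∀ X Y, B X Y = B Y X)
    (hp : ∀ X, X ≠ 0 → 0 < B X X) {R R' : V →ₗ[ℝ] V} (h1 : ∀ X Y, B (R X) Y = B X (R Y))
    (h1' : ∀ X Y, B (R' X) Y = B X (R' Y)) (h2 : ∀ X, X ≠ 0 → 0 < B (R X) X)
    (h2' : ∀ X, X ≠ 0 → 0 < B (R' X) X) (h : R ∘ₗ R = R' ∘ₗ R') : R = R' := by
  let c := coreOfBilin B hs hp
  let : NormedAddCommGroup V := c.toNormedAddCommGroup
  let : InnerProductSpace ℝ V := InnerProductSpace.ofCore c.toCore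
  have hsym : (R - R').IsSymmetric := fun X Y => by
    change B (R X - R' X) Y = B X (R Y - R' Y)
    rw [map_sub, map_sub, LinearMap.sub_apply, h1, h1']
  let b := hsym.eigenvectorBasis rfl
  let l := hsym.eigenvalues rfl
  have hb : ∀ i, b i ≠ 0 := fun i => b.orthonormal.ne_zero i
  have hT : ∀ i, R (b i) - R' (b i) = l i • b i := fun i => hsym.apply_eigenvectorBasis rfl i
  have hl : ∀ i, l i = 0 := fun i => by
    have e1 : R (R (b i) - R' (b i)) + (R (R' (b i)) - R' (R' (b i))) = 0 := by
      have := DFunLike.congr_fun h (b i)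
      simp only [LinearMap.comp_apply] at this
      rw [map_sub, this]
      abel
    have e2 := congrArg (fun v => B v (b i)) e1
    have e3 : B (R (R' (b i)) - R' (R' (b i))) (b i) = l i * B (R' (b i)) (b i) := by
      rw [map_sub, LinearMap.sub_apply, h1 (R' (b i)), h1' (R' (b i)), ← map_sub, hT, map_smul,
        smul_eq_mul]
    simp only [map_add, LinearMap.add_apply, e3, hT, map_smul, LinearMap.smul_apply,
      smul_eq_mul, map_zero, LinearMap.zero_apply, ← mul_add] at e2
    exact (mul_eq_zero.1 e2).resolve_right (add_pos (h2 _ (hb i)) (h2' _ (hb i))).ne'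
  refine b.toBasis.ext fun i => ?_
  rw [OrthonormalBasis.coe_toBasis, ← sub_eq_zero, hT, hl, zero_smul]

section Frames

variable {E : Type*} [NormedAddCommGroup E] [NormedSpace ℝ E] [FiniteDimensional ℝ E]
  {H : Type*} [TopologicalSpace H] {I : ModelWithCorners ℝ E H} [I.Boundaryless]
  {G : Type*} [TopologicalSpace G] [ChartedSpace H G] [Group G] [LieGroup I ∞ G]
  [CompactSpace G] [MeasurableSpace G] [BorelSpace G]
  [LieAlgebra.IsSemisimple ℝ (GroupLieAlgebra I G)] {K : Subgroup G}

theorem AdK_apply_inv (s : K) (v : mm I K) : AdK I K s (AdK I K s⁻¹ v) = v :=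
  Subtype.ext (Ad_apply_inv I (s : G) v)

theorem AdK_inv_apply (s : K) (v : mm I K) : AdK I K s⁻¹ (AdK I K s v) = v :=
  Subtype.ext (Ad_inv_apply I (s : G) v)

variable (I K) in
/-- The restriction of `Kil` to `𝔪`. -/
def KilM : LinearMap.BilinForm ℝ (mm I K) := (Kil I G).compl₁₂ (mm I K).subtype (mm I K).subtype

theorem KilM_symm (v w : mm I K) : KilM I K v w = KilM I K w v := Kil_symm I _ _

theorem KilM_pos (v : mm I K) (hv : v ≠ 0) : 0 < KilM I K v v :=
  Kil_pos I _ fun h => hv (Subtype.ext h)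

theorem KilM_AdK (s : K) (v w : mm I K) : KilM I K (AdK I K s v) (AdK I K s w) = KilM I K v w :=
  Kil_Ad I _ _ _

namespace AlmostHermitian

variable (h : AlmostHermitian I K)

theorem metricOp_spec (X Y : mm I K) : h.g X Y = KilM I K (h.metricOp X) Y :=
  Classical.epsilon_spec (p := fun S : mm I K →ₗ[ℝ] mm I K =>
    ∀ X Y : mm I K, h.g X Y = Kil I G (S X : GroupLieAlgebra I G) (Y : GroupLieAlgebra I G))
    (exists_operator_of_bilin (KilM I K) h.g KilM_symm KilM_pos) X Y

theorem metricOpSqrt_spec :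
    (∀ X Y, KilM I K (h.metricOpSqrt X) Y = KilM I K X (h.metricOpSqrt Y)) ∧
    (∀ X, X ≠ 0 → 0 < KilM I K (h.metricOpSqrt X) X) ∧
    h.metricOpSqrt ∘ₗ h.metricOpSqrt = h.metricOp :=
  Classical.epsilon_spec (p := fun R : mm I K →ₗ[ℝ] mm I K =>
    (∀ X Y : mm I K, Kil I G (R X : GroupLieAlgebra I G) (Y : GroupLieAlgebra I G) =
      Kil I G (X : GroupLieAlgebra I G) (R Y : GroupLieAlgebra I G)) ∧
    (∀ X : mm I K, X ≠ 0 → 0 < Kil I G (R X : GroupLieAlgebra I G) (X : GroupLieAlgebra I G)) ∧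
    R ∘ₗ R = h.metricOp)
    (exists_sqrt_of_bilin (KilM I K) h.g KilM_symm KilM_pos h.symm h.pos h.metricOp h.metricOp_spec)

theorem isUnit_metricOpSqrt : IsUnit (h.metricOpSqrt : Module.End ℝ (mm I K)) := by
  rw [LinearMap.isUnit_iff_ker_eq_bot, LinearMap.ker_eq_bot']
  intro X hX
  by_contra hne
  have := h.metricOpSqrt_spec.2.1 X hne
  rw [hX, map_zero, LinearMap.zero_apply] at this
  exact lt_irrefl _ this

theorem metricOpSqrt_invSqrt (X : mm I K) : h.metricOpSqrt (h.metricOpInvSqrt X) = X :=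
  DFunLike.congr_fun (Ring.mul_inverse_cancel _ h.isUnit_metricOpSqrt) X

theorem metricOpInvSqrt_sqrt (X : mm I K) : h.metricOpInvSqrt (h.metricOpSqrt X) = X :=
  DFunLike.congr_fun (Ring.inverse_mul_cancel _ h.isUnit_metricOpSqrt) X

theorem g_AdK_left (s : K) (X Y : mm I K) : h.g (AdK I K s X) Y = h.g X (AdK I K s⁻¹ Y) := by
  rw [← h.g_Ad s X, AdK_apply_inv]

theorem metricOp_AdK (s : K) (X : mm I K) :
    h.metricOp (AdK I K s X) = AdK I K s (h.metricOp X) := by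
  rw [← sub_eq_zero]
  by_contra hne
  refine (KilM_pos _ hne).ne' ?_
  have : ∀ Y, KilM I K (h.metricOp (AdK I K s X) - AdK I K s (h.metricOp X)) Y = 0 := fun Y => by
    rw [map_sub, LinearMap.sub_apply, ← metricOp_spec, ← AdK_apply_inv s Y, KilM_AdK,
      ← metricOp_spec, h.g_Ad, sub_self]
  exact this _

theorem metricOpSqrt_AdK (s : K) (X : mm I K) :
    h.metricOpSqrt (AdK I K s X) = AdK I K s (h.metricOpSqrt X) := by
  obtain ⟨h1, h2, h3⟩ := h.metricOpSqrt_spec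
  have hK : ∀ (s : K) X Y, KilM I K (AdK I K s X) Y = KilM I K X (AdK I K s⁻¹ Y) :=
    fun s X Y => by rw [← KilM_AdK s X, AdK_apply_inv]
  have h3' : ∀ X, h.metricOpSqrt (h.metricOpSqrt X) = h.metricOp X := DFunLike.congr_fun h3
  have e : AdK I K s⁻¹ ∘ₗ h.metricOpSqrt ∘ₗ AdK I K s = h.metricOpSqrt := by
    refine sqrt_unique (KilM I K) KilM_symm KilM_pos (fun X Y => ?_) h1 (fun X hX => ?_) h2 ?_
    · simp only [LinearMap.comp_apply]
      rw [hK, inv_inv, h1, hK]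
    · simp only [LinearMap.comp_apply]
      rw [hK, inv_inv]
      refine h2 _ fun h0 => hX ?_
      rw [← AdK_inv_apply s X, h0, map_zero]
    · refine LinearMap.ext fun X => ?_
      simp only [LinearMap.comp_apply]
      rw [AdK_apply_inv, h3', h3', metricOp_AdK, AdK_inv_apply]
  have := DFunLike.congr_fun e X
  simp only [LinearMap.comp_apply] at this
  rw [← this, AdK_apply_inv]

theorem metricOpInvSqrt_AdK (s : K) (X : mm I K) :
    h.metricOpInvSqrt (AdK I K s X) = AdK I K s (h.metricOpInvSqrt X) := by
  conv_lhs => rw [← h.metricOpSqrt_invSqrt X, ← metricOpSqrt_AdK, metricOpInvSqrt_sqrt]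

theorem g_metricOpInvSqrt_left (X Y : mm I K) :
    h.g (h.metricOpInvSqrt X) Y = KilM I K X (h.metricOpSqrt Y) := by
  obtain ⟨h1, h2, h3⟩ := h.metricOpSqrt_spec
  rw [metricOp_spec, ← h3, LinearMap.comp_apply, metricOpSqrt_invSqrt, h1]

theorem g_metricOpInvSqrt (X Y : mm I K) :
    h.g (h.metricOpInvSqrt X) Y = h.g X (h.metricOpInvSqrt Y) := by
  have h1 := h.metricOpSqrt_spec.1
  rw [g_metricOpInvSqrt_left, h.symm X, g_metricOpInvSqrt_left, ← h1, KilM_symm]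

theorem exists_isStandardFrame :
    ∃ (n : ℕ) (W : Fin n → vectorField I K), h.IsStandardFrame W := by
  refine ⟨Module.finrank ℝ (GroupLieAlgebra I G), fun j =>
    ⟨fun x => h.metricOpInvSqrt ((fundField I K (kilBasis I j)).1 x),
      (fundField I K (kilBasis I j)).2.1.comp_linear _, fun x s => ?_⟩, fun V x => ?_⟩
  · beta_reduce
    rw [(fundField I K (kilBasis I j)).2.2, metricOpInvSqrt_AdK]
  · simp only [g_metricOpInvSqrt_left, ← map_smul]
    rw [← map_sum]
    have := sum_Kil_fundField I K x (h.metricOpSqrt (V.1 x))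
    exact (h.metricOpInvSqrt_sqrt _).symm.trans (congrArg _ this)

/-- The trace `∑ₚ L_{eₚ} eᵖ` of `L = ∇ - ∇ᶜ` with respect to `g`. -/
def diffTrace (D : Connection I K) : mm I K :=
  ∑ p, D.diffBilin (Module.finBasis ℝ (mm I K) p)
    (h.g.dualBasis h.nondegenerate (Module.finBasis ℝ (mm I K)) p)

theorem sum_diffBilin (D : Connection I K) {ι : Type*} [Fintype ι] {a b : ι → mm I K}
    (hab : IsResolution h.g a b) : ∑ j, D.diffBilin (a j) (b j) = h.diffTrace D :=
  hab.sum_eq h.pos (isResolution_dualBasis _ _ _) D.diffBilin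

theorem sum_diff_of_isStandardFrame {D : Connection I K} (hD : D.IsInvariant) {n : ℕ}
    {W : Fin n → vectorField I K} (hW : h.IsStandardFrame W) (x : G) :
    ∑ j, D.diff (W j) (W j) x = h.diffTrace D := by
  simp only [D.diff_eq_diffBilin hD]
  refine h.sum_diffBilin D (a := fun j => (W j).1 x) (b := fun j => (W j).1 x) fun v => ?_
  have := hW (extendField I K x v) x
  rwa [extendField_apply_self] at this

theorem AdK_diffTrace {D : Connection I K} (hD : D.IsInvariant) (s : K) :
    AdK I K s (h.diffTrace D) = h.diffTrace D := by
  conv_lhs => rw [diffTrace, map_sum]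
  simp only [← D.diffBilin_AdK hD]
  refine h.sum_diffBilin D (a := fun p => AdK I K s (Module.finBasis ℝ (mm I K) p))
    (b := fun p => AdK I K s (h.g.dualBasis h.nondegenerate (Module.finBasis ℝ (mm I K)) p))
    fun v => ?_
  simp only [g_AdK_left, ← map_smul]
  rw [← map_sum, ← isResolution_dualBasis _ h.nondegenerate (Module.finBasis ℝ (mm I K)),
    AdK_apply_inv]

theorem ikedaSum_eq {D : Connection I K} (hD : D.IsInvariant)
    {Y : Module.Basis (Fin (Module.finrank ℝ (mm I K))) ℝ (mm I K)} (hY : h.IsOrthonormal Y) :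
    h.ikedaSum D Y = - h.diffTrace D := by
  have h1 : IsResolution h.g (fun p => h.metricOpSqrt (Y p)) (fun p => h.metricOpInvSqrt (Y p)) :=
    fun v => by
    simp only [g_metricOpInvSqrt, ← map_smul]
    rw [← map_sum, ← isResolution_orthonormal h.g Y hY, metricOpSqrt_invSqrt]
  rw [← h.sum_diffBilin D h1, ikedaSum, ← Finset.sum_neg_distrib]
  refine Finset.sum_congr rfl fun p _ => ?_
  rw [D.diffEnd_eq_diffBilin hD, fundField_apply, inv_one, Ad_one, LinearMap.id_apply, projm_coe,
    map_neg, LinearMap.neg_apply]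

end AlmostHermitian

end Frames

namespace HermSpace

variable {M : Type*} [AddCommGroup M] [Module ℝ M] (h : HermSpace M)

/-- The inner product of spinors as a real-bilinear map. -/
def spinForm : h.Spinor →ₗ[ℝ] h.Spinor →ₗ[ℝ] ℂ :=
  LinearMap.mk₂ ℝ h.spinInner h.spinInner_add_left
    (fun c ψ φ => by
      rw [← Complex.coe_smul, spinInner_smul_left, Complex.conj_ofReal, Complex.real_smul])
    h.spinInner_add_right
    (fun c ψ φ => by rw [← Complex.coe_smul, spinInner_smul_right, Complex.real_smul])

theorem spinForm_apply (ψ φ : h.Spinor) : h.spinForm ψ φ = h.spinInner ψ φ := rfl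

theorem clifford_add (X Y : M) (ψ : h.Spinor) :
    h.clifford (X + Y) ψ = h.clifford X ψ + h.clifford Y ψ := by
  simp only [clifford_apply, annihilation, herm_add, map_add, LinearMap.add_apply, add_mul,
    ← smul_add]
  congr 1
  abel

theorem clifford_sum {ι : Type*} (s : Finset ι) (X : ι → M) (ψ : h.Spinor) :
    h.clifford (∑ i ∈ s, X i) ψ = ∑ i ∈ s, h.clifford (X i) ψ :=
  map_sum (AddMonoidHom.mk' (fun X => h.clifford X ψ) fun X Y => h.clifford_add X Y ψ) X s

theorem clifford_zero (ψ : h.Spinor) : h.clifford 0 ψ = 0 :=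
  map_zero (AddMonoidHom.mk' (fun X => h.clifford X ψ) fun X Y => h.clifford_add X Y ψ)

theorem spinInner_ι_clifford_one (Z : M) :
    h.spinInner (ExteriorAlgebra.ι ℂ (h.toMJ Z)) (h.clifford Z 1) =
      Complex.I * h.herm Z (h.toMJ Z) := by
  rw [clifford_apply, annihilation_one, zero_add, spinInner_smul_right, spinInner_ι_mul,
    ← mul_one (ExteriorAlgebra.ι ℂ (h.toMJ Z)), annihilation_ι_mul, annihilation_one, mul_zero,
    sub_zero, spinInner_smul_left, spinInner_one, map_one, map_one, mul_one, herm_symm]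

theorem herm_self_ne_zero {Z : M} (hZ : Z ≠ 0) : h.herm Z (h.toMJ Z) ≠ 0 := fun h0 => by
  have := congrArg Complex.re h0
  simp [herm] at this
  exact (h.pos Z hZ).ne' this

end HermSpace

section Dirac

open MeasureTheory

variable {E : Type*} [NormedAddCommGroup E] [NormedSpace ℝ E] [FiniteDimensional ℝ E]
  {H : Type*} [TopologicalSpace H] {I : ModelWithCorners ℝ E H} [I.Boundaryless]
  {G : Type*} [TopologicalSpace G] [ChartedSpace H G] [Group G] [LieGroup I ∞ G]

theorem SmoothTo.continuous_complex {f : G → ℂ} (hf : SmoothTo I f) : Continuous f := by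
  have h1 : f = fun x => ((f x).re : ℂ) + (f x).im * Complex.I :=
    funext fun x => (Complex.re_add_im (f x)).symm
  have hre : Continuous fun x => (f x).re := (hf Complex.reLm).continuous
  have him : Continuous fun x => (f x).im := (hf Complex.imLm).continuous
  rw [h1]
  fun_prop

variable [CompactSpace G] [MeasurableSpace G] [BorelSpace G] (μ : Measure G) [μ.IsHaarMeasure]

theorem SmoothTo.integrable {f : G → ℂ} (hf : SmoothTo I f) : Integrable f μ :=
  hf.continuous_complex.integrable_of_hasCompactSupport (HasCompactSupport.of_compactSpace _)

theorem integral_vecDeriv {f : G → ℂ} (hf : SmoothTo I f) (v : GroupLieAlgebra I G) :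
    ∫ x, vecDeriv I f x v ∂μ = 0 := by
  unfold vecDeriv
  rw [integral_finsetSum]
  · refine Finset.sum_eq_zero fun i _ => ?_
    rw [integral_smul_const, integral_dirDeriv μ (hf _), zero_smul]
  · intro i _
    exact ((contMDiff_dirDeriv (hf _) v).continuous.integrable_of_hasCompactSupport
      (HasCompactSupport.of_compactSpace _)).smul_const _

variable [LieAlgebra.IsSemisimple ℝ (GroupLieAlgebra I G)] {K : Subgroup G}

namespace AlmostHermitian

variable (h : AlmostHermitian I K) {D : Connection I K} (hD : D.IsInvariant)
  (hg : h.IsCompatible D) (hJ : h.CommutesWithJ D)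

/-- The endomorphism `L_v` of `𝔪_J`. -/
def diffComplex (v : mm I K) : h.MJ →ₗ[ℂ] h.MJ :=
  h.complexify (D.diffBilin v) fun X => D.diffBilin_J hD hJ v X

include hg in
theorem diffComplex_skew (v X Y : mm I K) :
    h.g (h.toMJ.symm (h.diffComplex hD hJ v (h.toMJ X))) Y =
      - h.g X (h.toMJ.symm (h.diffComplex hD hJ v (h.toMJ Y))) :=
  D.diffBilin_skew hD hg v X Y

theorem diffSpin_eq (V : vectorField I K) (x : G) :
    h.diffSpin D V x = h.extDer (h.diffComplex hD hJ (V.1 x)) := by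
  have hL : ∃ l : h.MJ →ₗ[ℂ] h.MJ, ∀ w, l (h.toMJ w) = h.toMJ (D.diffEnd V x w) :=
    ⟨h.diffComplex hD hJ (V.1 x), fun w => by rw [D.diffEnd_eq_diffBilin hD]; rfl⟩
  unfold diffSpin
  rw [dif_pos hL]
  congr 1
  refine LinearMap.ext fun w => ?_
  have := hL.choose_spec (h.toMJ.symm w)
  rw [AddEquiv.apply_symm_apply, D.diffEnd_eq_diffBilin hD] at this
  exact this

theorem dirac_eq (ψ : G → h.Spinor) (x : G) : h.dirac D ψ x =
    ∑ p, h.clifford (h.g.dualBasis h.nondegenerate (Module.finBasis ℝ (mm I K)) p)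
      (vecDeriv I ψ x (Module.finBasis ℝ (mm I K) p : GroupLieAlgebra I G) +
        h.extDer (h.diffComplex hD hJ (Module.finBasis ℝ (mm I K) p)) (ψ x)) := by
  unfold dirac spinConnection
  refine Finset.sum_congr rfl fun p _ => ?_
  rw [h.diffSpin_eq hD hJ, extendField_apply_self]

include hD hJ in
theorem smoothTo_dirac {ψ : G → h.Spinor} (hψ : SmoothTo I ψ) :
    SmoothTo I fun x => h.dirac D ψ x := by
  simp only [h.dirac_eq hD hJ]
  refine SmoothTo.sum _ fun p => ?_
  exact ((hψ.vecDeriv _).add (hψ.comp_linear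
    ((h.extDer (h.diffComplex hD hJ _)).restrictScalars ℝ))).comp_linear
      ((h.clifford _).restrictScalars ℝ)

/-- The failure of the Dirac operator to be symmetric is a divergence plus Clifford multiplication
by the trace of `L`. -/
theorem spinInner_dirac_sub (hD : D.IsInvariant) (hg : h.IsCompatible D) (hJ : h.CommutesWithJ D)
    {ψ φ : G → h.Spinor} (hψ : SmoothTo I ψ) (hφ : SmoothTo I φ) (x : G) :
    h.spinInner (h.dirac D ψ x) (φ x) - h.spinInner (ψ x) (h.dirac D φ x) =
      h.spinInner (ψ x) (h.clifford (h.diffTrace D) (φ x)) -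
      ∑ p, vecDeriv I (fun y => h.spinInner (ψ y)
        (h.clifford (h.g.dualBasis h.nondegenerate (Module.finBasis ℝ (mm I K)) p) (φ y))) x
          (Module.finBasis ℝ (mm I K) p : GroupLieAlgebra I G) := by
  rw [h.dirac_eq hD hJ, h.dirac_eq hD hJ, diffTrace, HermSpace.clifford_sum]
  simp only [← HermSpace.spinForm_apply, map_sum, LinearMap.sum_apply, ← Finset.sum_sub_distrib]
  refine Finset.sum_congr rfl fun p _ => ?_
  generalize Module.finBasis ℝ (mm I K) p = e
  generalize h.g.dualBasis h.nondegenerate (Module.finBasis ℝ (mm I K)) p = e'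
  have h1 := vecDeriv_bilin hψ (hφ.comp_linear ((h.clifford e').restrictScalars ℝ)) h.spinForm x
    (e : GroupLieAlgebra I G)
  rw [← map_vecDeriv hφ] at h1
  refine Eq.trans ?_ (congrArg _ h1.symm)
  simp only [LinearMap.coe_restrictScalars, map_add, LinearMap.add_apply]
  simp only [HermSpace.spinForm_apply, HermSpace.spinInner_clifford_left]
  have hs := h.diffComplex_skew hD hg hJ e
  rw [h.spinInner_extDer_left _ hs, h.extDer_clifford _ hs, h.spinInner_add_right]
  change _ = h.spinInner (ψ x) (h.clifford (h.toMJ.symm (h.diffComplex hD hJ e (h.toMJ e'))) (φ x)) - _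
  ring

theorem integral_dirac_sub (hD : D.IsInvariant) (hg : h.IsCompatible D) (hJ : h.CommutesWithJ D)
    {ψ φ : G → h.Spinor} (hψ : SmoothTo I ψ) (hφ : SmoothTo I φ) :
    ∫ x, h.spinInner (h.dirac D ψ x) (φ x) ∂μ - ∫ x, h.spinInner (ψ x) (h.dirac D φ x) ∂μ =
      ∫ x, h.spinInner (ψ x) (h.clifford (h.diffTrace D) (φ x)) ∂μ := by
  have hF : ∀ X, SmoothTo I fun y => h.spinInner (ψ y) (h.clifford X (φ y)) := fun X =>
    hψ.bilin (hφ.comp_linear ((h.clifford X).restrictScalars ℝ)) h.spinForm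
  have hsub := integral_sub (((h.smoothTo_dirac hD hJ hψ).bilin hφ h.spinForm).integrable μ)
    ((hψ.bilin (h.smoothTo_dirac hD hJ hφ) h.spinForm).integrable μ)
  simp only [HermSpace.spinForm_apply] at hsub
  rw [← hsub]
  simp only [h.spinInner_dirac_sub hD hg hJ hψ hφ]
  have hi : ∀ p, Integrable (fun x => vecDeriv I (fun y => h.spinInner (ψ y)
        (h.clifford (h.g.dualBasis h.nondegenerate (Module.finBasis ℝ (mm I K)) p) (φ y))) x
          (Module.finBasis ℝ (mm I K) p : GroupLieAlgebra I G)) μ := fun p =>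
    ((hF _).vecDeriv _).integrable μ
  rw [integral_sub ((hF _).integrable μ) (integrable_finsetSum _ fun p _ => hi p),
    integral_finsetSum _ fun p _ => hi p]
  simp only [integral_vecDeriv μ (hF _), Finset.sum_const_zero, sub_zero]

end AlmostHermitian

/-! ### Existence of spinor fields -/

theorem contMDiff_parametric_integral {A : Type*} [TopologicalSpace A] [CompactSpace A]
    [MeasurableSpace A] [BorelSpace A] (ν : Measure A) [IsFiniteMeasure ν] {j : A → G}
    (hj : Continuous j) {c : A → ℝ} (hc : Continuous c) {b : G → ℝ}
    (hb : ContMDiff I 𝓘(ℝ, ℝ) ∞ b) : ContMDiff I 𝓘(ℝ, ℝ) ∞ fun x => ∫ a, c a * b (x * j a) ∂ν := by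
  intro x
  have h1 := contDiffOn_parametric_integral ν hj hc (isOpen_extChartAt_target x)
    (contMDiffOn_chart_mul hb x)
  have h2 := (h1.contDiffAt (extChartAt_target_mem_nhds x)).contMDiffAt.comp x
    (contMDiffAt_extChartAt (I := I) (n := ∞))
  refine h2.congr_of_eventuallyEq ?_
  filter_upwards [extChartAt_source_mem_nhds (I := I) x] with z hz
  simp only [Function.comp_apply, (extChartAt I x).left_inv hz]

theorem exists_equivariant_function [T2Space G] (hK : IsClosed (K : Set G)) (χ : K →ₜ* Circle) :
    ∃ F : G → ℂ, SmoothTo I F ∧ (∀ (x : G) (s : K), F (x * s) = starRingEnd ℂ (χ s : ℂ) * F x) ∧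
      F 1 ≠ 0 := by
  have : IsTopologicalGroup G := topologicalGroup_of_lieGroup I ∞
  have : CompactSpace K := isCompact_iff_compactSpace.1 hK.isCompact
  let ν : Measure K := Measure.haar
  have hχ : Continuous fun s : K => (χ s : ℂ) := continuous_subtype_val.comp χ.continuous_toFun
  have hN : {s : K | 0 < (χ s : ℂ).re} ∈ nhds (1 : K) :=
    (isOpen_lt continuous_const (Complex.continuous_re.comp hχ)).mem_nhds (by simp)
  rw [nhds_subtype_eq_comap, Filter.mem_comap] at hN
  obtain ⟨N, hN1, hN2⟩ := hN
  obtain ⟨b, -, hb⟩ := (SmoothBumpFunction.nhds_basis_tsupport (I := I) (1 : G)).mem_iff.1 hN1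
  have hbs : ContMDiff I 𝓘(ℝ, ℝ) ∞ b := b.contMDiff
  have hcont : ∀ x : G, Continuous fun s : K => (χ s : ℂ) * (b (x * s) : ℂ) := fun x =>
    hχ.mul (Complex.continuous_ofReal.comp (hbs.continuous.comp (by fun_prop)))
  have hint : ∀ x : G, Integrable (fun s : K => (χ s : ℂ) * (b (x * s) : ℂ)) ν := fun x =>
    (hcont x).integrable_of_hasCompactSupport (HasCompactSupport.of_compactSpace _)
  have hl : ∀ (l : ℂ →ₗ[ℝ] ℝ) (x : G), l (∫ s : K, (χ s : ℂ) * (b (x * s) : ℂ) ∂ν) =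
      ∫ s : K, l (χ s : ℂ) * b (x * s) ∂ν := fun l x => by
    refine (l.toContinuousLinearMap.integral_comp_comm (hint x)).symm.trans ?_
    refine integral_congr_ae (Filter.Eventually.of_forall fun s => ?_)
    change l ((χ s : ℂ) * (b (x * s) : ℂ)) = l (χ s : ℂ) * b (x * s)
    rw [mul_comm, ← Complex.real_smul, map_smul, smul_eq_mul, mul_comm]
  refine ⟨fun x => ∫ s : K, (χ s : ℂ) * (b (x * s) : ℂ) ∂ν, fun l => ?_, fun x s => ?_, fun h0 => ?_⟩
  · simp only [hl]
    exact contMDiff_parametric_integral ν continuous_subtype_val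
      (l.continuous_of_finiteDimensional.comp hχ) hbs
  · have h1 := integral_mul_left_eq_self (μ := ν)
      (fun t : K => (χ (s⁻¹ * t) : ℂ) * (b (x * t) : ℂ)) s
    beta_reduce
    rw [← integral_const_mul]
    refine Eq.trans ?_ (h1.trans ?_)
    · refine integral_congr_ae (Filter.Eventually.of_forall fun t => ?_)
      simp [mul_assoc]
    · refine integral_congr_ae (Filter.Eventually.of_forall fun t => ?_)
      simp only [map_mul, map_inv, Circle.coe_mul, Circle.coe_inv_eq_conj, mul_assoc]
  · have h1 := hl Complex.reLm 1
    beta_reduce at h0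
    rw [h0, map_zero] at h1
    refine h1.not_lt ?_
    refine Continuous.integral_pos_of_hasCompactSupport_nonneg_nonzero (x := (1 : K)) ?_
      (HasCompactSupport.of_compactSpace _) (fun s => ?_) ?_
    · exact (Complex.continuous_re.comp hχ).mul (hbs.continuous.comp (by fun_prop))
    · by_cases hs : (s : G) ∈ N
      · have : 0 < (χ s : ℂ).re := hN2 hs
        exact mul_nonneg this.le b.nonneg
      · have : b (s : G) = 0 := image_eq_zero_of_notMem_tsupport fun h => hs (hb h)
        simp [this]
    · simp

namespace AlmostHermitian

variable (h : AlmostHermitian I K)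

theorem isSpinorField_smul {χ : K →ₜ* Circle} {F : G → ℂ} (hF : SmoothTo I F)
    (hFs : ∀ (x : G) (s : K), F (x * s) = starRingEnd ℂ (χ s : ℂ) * F x) {w : h.Spinor}
    (hw : ∀ s, h.AdSpin s w = w) : h.IsSpinorField χ fun x => F x • w :=
  ⟨hF.comp_linear ((LinearMap.toSpanSingleton ℂ h.Spinor w).restrictScalars ℝ), fun x s => by
    beta_reduce
    rw [map_smul, hw, hFs, mul_smul]⟩

theorem isFormallySelfAdjoint_iff [T2Space G] (hK : IsClosed (K : Set G)) {D : Connection I K}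
    (hD : D.IsInvariant) (hg : h.IsCompatible D) (hJ : h.CommutesWithJ D) (χ : K →ₜ* Circle) :
    h.IsFormallySelfAdjoint μ D χ ↔ h.diffTrace D = 0 := by
  refine ⟨fun hsa => ?_, fun hZ ψ φ hψ hφ => ?_⟩
  · obtain ⟨F, hF, hFs, hF1⟩ := exists_equivariant_function (I := I) hK χ
    by_contra hZ
    set Z := h.diffTrace D with hZdef
    have h1 : h.IsSpinorField χ fun x => F x • (1 : h.Spinor) :=
      h.isSpinorField_smul hF hFs fun s => map_one _
    have h2 : h.IsSpinorField χ fun x => F x • ExteriorAlgebra.ι ℂ (h.toMJ Z) :=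
      h.isSpinorField_smul hF hFs fun s => by
        unfold AdSpin
        rw [ExteriorAlgebra.map_apply_ι]
        exact congrArg (fun X => ExteriorAlgebra.ι ℂ (h.toMJ X)) (h.AdK_diffTrace hD s)
    have h3 := h.integral_dirac_sub μ hD hg hJ h2.1 h1.1
    rw [hsa _ _ h2 h1, sub_self, ← hZdef] at h3
    simp only [map_smul, HermSpace.spinInner_smul_left, HermSpace.spinInner_smul_right,
      HermSpace.spinInner_ι_clifford_one, ← mul_assoc, Complex.mul_conj] at h3
    rw [integral_mul_const, integral_mul_const, integral_complex_ofReal] at h3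
    have h4 : 0 < ∫ x, Complex.normSq (F x) ∂μ :=
      (Complex.continuous_normSq.comp
        hF.continuous_complex).integral_pos_of_hasCompactSupport_nonneg_nonzero
        (HasCompactSupport.of_compactSpace _) (fun x => Complex.normSq_nonneg _) (x := 1)
        (by simpa using hF1)
    refine mul_ne_zero (mul_ne_zero ?_ Complex.I_ne_zero) (h.herm_self_ne_zero hZ) h3.symm
    exact_mod_cast h4.ne'
  · rw [← sub_eq_zero, h.integral_dirac_sub μ hD hg hJ hψ.1 hφ.1, hZ]
    simp only [HermSpace.clifford_zero]
    simp [HermSpace.spinInner]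

end AlmostHermitian

end Dirac

end HomDirac

end

theorem corollary7p7
    {E : Type*} [NormedAddCommGroup E] [NormedSpace ℝ E] [FiniteDimensional ℝ E]
    {H : Type*} [TopologicalSpace H] (I : ModelWithCorners ℝ E H) [I.Boundaryless]
    {G : Type*} [TopologicalSpace G] [ChartedSpace H G] [Group G] [LieGroup I ∞ G]
    [T2Space G] [CompactSpace G] [LieAlgebra.IsSemisimple ℝ (GroupLieAlgebra I G)]
    [MeasurableSpace G] [BorelSpace G] (μ : MeasureTheory.Measure G) [μ.IsHaarMeasure]
    (K : Subgroup G) (hK : IsClosed (K : Set G))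
    (h : HomDirac.AlmostHermitian I K) (χ : K →ₜ* Circle)
    (D : HomDirac.Connection I K) (hD : D.IsInvariant) (hg : h.IsCompatible D)
    (hJ : h.CommutesWithJ D) :
    (h.IsFormallySelfAdjoint μ D χ ↔
      ∀ (n : ℕ) (W : Fin n → HomDirac.vectorField I K), h.IsStandardFrame W →
        ∀ x : G, ∑ j, D.diff (W j) (W j) x = 0) ∧
    (h.IsFormallySelfAdjoint μ D χ ↔
      ∃ (n : ℕ) (W : Fin n → HomDirac.vectorField I K), h.IsStandardFrame W ∧
        ∀ x : G, ∑ j, D.diff (W j) (W j) x = 0) ∧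
    (∃ Z : HomDirac.mm I K, (∀ s : K, HomDirac.AdK I K s Z = Z) ∧
      ∀ (n : ℕ) (W : Fin n → HomDirac.vectorField I K), h.IsStandardFrame W →
        ∀ x : G, ∑ j, D.diff (W j) (W j) x = Z) ∧
    (h.IsFormallySelfAdjoint μ D χ ↔
      ∀ Y : Module.Basis (Fin (Module.finrank ℝ (HomDirac.mm I K))) ℝ (HomDirac.mm I K),
        h.IsOrthonormal Y → h.ikedaSum D Y = 0) ∧
    (h.IsFormallySelfAdjoint μ D χ ↔
      ∃ Y : Module.Basis (Fin (Module.finrank ℝ (HomDirac.mm I K))) ℝ (HomDirac.mm I K),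
        h.IsOrthonormal Y ∧ h.ikedaSum D Y = 0) := by
  have hsa := h.isFormallySelfAdjoint_iff μ hK hD hg hJ χ
  have hsum : ∀ {n : ℕ} {W : Fin n → HomDirac.vectorField I K}, h.IsStandardFrame W →
      ∀ x : G, ∑ j, D.diff (W j) (W j) x = h.diffTrace D := fun hW x =>
    h.sum_diff_of_isStandardFrame hD hW x
  obtain ⟨n, W, hW⟩ := h.exists_isStandardFrame
  obtain ⟨Y, hY⟩ := HomDirac.exists_orthonormal_basis h.g h.symm h.pos
  refine ⟨⟨fun hs n W hW x => ?_, fun hs => ?_⟩, ⟨fun hs => ⟨n, W, hW, fun x => ?_⟩, ?_⟩,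
    ⟨h.diffTrace D, h.AdK_diffTrace hD, fun n W hW x => hsum hW x⟩,
    ⟨fun hs Y hY => ?_, fun hs => ?_⟩, ⟨fun hs => ⟨Y, hY, ?_⟩, ?_⟩⟩
  · rw [hsum hW, hsa.1 hs]
  · rw [hsa, ← hsum hW 1, hs n W hW 1]
  · rw [hsum hW, hsa.1 hs]
  · rintro ⟨n, W, hW, hs⟩
    rw [hsa, ← hsum hW 1, hs 1]
  · rw [h.ikedaSum_eq hD hY, hsa.1 hs, neg_zero]
  · rw [hsa, ← neg_eq_zero, ← h.ikedaSum_eq hD hY, hs Y hY]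
  · rw [h.ikedaSum_eq hD hY, hsa.1 hs, neg_zero]
  · rintro ⟨Y, hY, hs⟩
    rw [hsa, ← neg_eq_zero, ← h.ikedaSum_eq hD hY, hs]
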